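/- For a nonnegative, nonincreasing (finite-valued) function $f$ on $(0,\infty)$ let $$H^*f(x)=\int_x^\infty f(t)\,\frac{dt}{t}\in[0,\infty],\qquad (H^*-I)f(x)=H^*f(x)-f(x),\qquad x>0,$$ and let $\|g\|_p=\big(\int_0^\infty|g(x)|^p\,dx\big)^{1/p}\in[0,\infty]$. Put $C_p=\int_0^1|1+\ln x|^p\,dx$. **Theorem.** Let $1\le p<\infty$. (a) If $1\le p\le 2$, then for every nonnegative, nonincreasing $f\in L^p(0,\infty)$, $$(p-1)\|f\|_p\le\|(H^*-I)f\|_p\le C_p^{1/p}\|f\|_p .$$ (b) If $2\le p<\infty$, then for every nonnegative, nonincreasing $f\in L^p(0,\infty)$, $$C_p^{1/p}\|f\|_p\le\|(H^*-I)f\|_p\le (p-1)\|f\|_p .$$ The right-hand inequalities in (a) and (b) also hold, with values in $[0,\infty]$, for nonnegative, nonincreasing $f\notin L^p(0,\infty)$. The constants are optimal in all four inequalities: in each of (a) and (b), the constant on the left is the largest, and the constant on the right is the smallest, for which the inequality holds for all nonnegative, nonincreasing $f\in L^p(0,\infty)$. -/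

import Mathlib

open MeasureTheory Set
open scoped ENNReal

noncomputable section

/-- The dual Hardy operator `H* f (x) = ∫_x^∞ f(t) dt/t` of a nonnegative function `f` on `(0,∞)`;
the value `∞` is allowed. Only the values of `f` on `(0,∞)` matter when `x > 0`. -/
def dualHardy (f : ℝ → ℝ) (x : ℝ) : ℝ≥0∞ :=
  ∫⁻ t in Ioi x, ENNReal.ofReal (f t / t)

/-- `(H* - I) f`, as an extended real: it is `+∞` where `H* f = ∞`, since `f` is finite. -/
def dualHardySubId (f : ℝ → ℝ) (x : ℝ) : EReal :=
  (dualHardy f x : EReal) - (f x : EReal)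

/-- The norm of `L^p(0,∞)`, `‖g‖_p = (∫_0^∞ |g(x)|^p dx)^{1/p}`, with values in `[0,∞]`. -/
def lpNormPos (p : ℝ) (g : ℝ → EReal) : ℝ≥0∞ :=
  (∫⁻ x in Ioi (0 : ℝ), (g x).abs ^ p) ^ (1 / p)

/-- The constant `C_p = ∫_0^1 |1 + ln x|^p dx`. -/
def hardyC (p : ℝ) : ℝ :=
  ∫ x in (0 : ℝ)..1, |1 + Real.log x| ^ p

/-- `f` is nonnegative and nonincreasing on `(0,∞)`. -/
def NonnegNonincr (f : ℝ → ℝ) : Prop :=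
  (∀ x, 0 < x → 0 ≤ f x) ∧ AntitoneOn f (Ioi 0)

/-- The inequality `c ‖f‖_p ≤ ‖(H* - I) f‖_p` for all nonnegative, nonincreasing `f ∈ L^p(0,∞)`. -/
def LowerBoundOnCone (p : ℝ) (c : ℝ≥0∞) : Prop :=
  ∀ f : ℝ → ℝ, NonnegNonincr f → lpNormPos p (fun x => (f x : EReal)) < ∞ →
    c * lpNormPos p (fun x => (f x : EReal)) ≤ lpNormPos p (dualHardySubId f)

/-- The inequality `‖(H* - I) f‖_p ≤ c ‖f‖_p` for all nonnegative, nonincreasing `f ∈ L^p(0,∞)`. -/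
def UpperBoundOnCone (p : ℝ) (c : ℝ≥0∞) : Prop :=
  ∀ f : ℝ → ℝ, NonnegNonincr f → lpNormPos p (fun x => (f x : EReal)) < ∞ →
    lpNormPos p (dualHardySubId f) ≤ c * lpNormPos p (fun x => (f x : EReal))

end

/-!
Both constants come from extremal profiles. On the indicator function of `(0, 1)` the quotient
`‖(H* - I) f‖_p / ‖f‖_p` is `C_p ^ (1 / p)`, and on the truncated powers `max x 1 ^ (-a)` it tends
to `p - 1` as `a` decreases to `1 / p`. This gives the optimality of all four constants.

The four inequalities are proved for step functions `f` with bounded support and carried over to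
`f ∈ L^p` by sampling: upper bounds by Fatou's lemma (`lintegral_abs_sub_rpow_le`), lower bounds by
dominated convergence (`le_lintegral_abs_sub_rpow`). For `f ∉ L^p` the right-hand sides of the
upper bounds are infinite.

The common tool for a step function with `F = H* f` is `integral_comp_gridHardy_nonpos`. Where `f`
is frozen at the value `b` on `(0, a)`, one has `F x = A + b log (a / x)` with `A = F a`, so the
substitution `x = a exp (-s)` turns the integral of `Θ (F, f)` over `(0, a)` into
`a ∫ Θ (A + b s, b) exp (-s) ds`. If this is nonincreasing in `b ≥ 0`, rebuilding `f` from `0` by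
raising it step by step on shrinking intervals `(0, a)` never increases `∫ Θ (F, f)`.

* For the constant `C_p`, take `Θ (F, f) = ±(|F - f| ^ p - C_p f ^ p)`. The required monotonicity is
  that of `b ↦ ∫ (|A + b (s - 1)| ^ p - |b (s - 1)| ^ p) exp (-s) ds`. Its derivative is a
  correlation between `s - 1` and a function which is symmetric about a point and monotone in the
  distance to it, with the direction depending on the sign of `p - 2`. Folding the half-line at that
  point leaves a signed density with a single sign change, which decides the sign
  (`integral_sub_one_mul_comp_abs_nonpos`).

* For the constant `p - 1`, take `Θ (F, f) = ±(F ^ p - p F ^ (p - 1) f)`, for which the integral is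
  independent of `b`; hence `∫ (F ^ p - p F ^ (p - 1) f) = 0`. A multiple of this integrand lies
  above `|F - f| ^ p - ((p - 1) f) ^ p` when `p ≥ 2` and below it when `1 < p ≤ 2`, with tangency at
  `F = p f` (`abs_sub_rpow_sub_le_of_two_le`, `le_abs_sub_rpow_sub_of_le_two`).
-/

/-! ### Integrals against the exponential density -/

/-- Polynomial growth is absorbed by `exp (s / 2)`. -/
theorem exists_one_add_rpow_le_mul_exp {q : ℝ} (hq : 0 ≤ q) :
    ∃ K : ℝ, 0 ≤ K ∧ ∀ s : ℝ, 0 ≤ s → (1 + s) ^ q ≤ K * Real.exp (s / 2) := by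
  refine ⟨(2 * q + 1) ^ q, by positivity, fun s hs => ?_⟩
  have h1 : 1 + s ≤ (2 * q + 1) * Real.exp (s / (2 * q + 1)) := by
    have := Real.add_one_le_exp (s / (2 * q + 1))
    calc 1 + s ≤ (2 * q + 1) * (s / (2 * q + 1) + 1) := by
          field_simp; linarith
      _ ≤ _ := by gcongr
  calc (1 + s) ^ q ≤ ((2 * q + 1) * Real.exp (s / (2 * q + 1))) ^ q := by
        gcongr
    _ = (2 * q + 1) ^ q * Real.exp (s / (2 * q + 1) * q) := by
        rw [Real.mul_rpow (by positivity) (by positivity), ← Real.exp_mul]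
    _ ≤ _ := by
        gcongr
        rw [div_mul_eq_mul_div, div_le_div_iff₀ (by positivity) (by positivity)]
        nlinarith

theorem integrableOn_mul_exp_neg_of_le {g : ℝ → ℝ} (hg : Measurable g) {K q : ℝ} (hq : 0 ≤ q)
    (hgK : ∀ s, 0 < s → |g s| ≤ K * (1 + s) ^ q) :
    IntegrableOn (fun s => g s * Real.exp (-s)) (Ioi 0) := by
  obtain ⟨L, hL0, hL⟩ := exists_one_add_rpow_le_mul_exp hq
  have hK : 0 ≤ K := by
    have := (abs_nonneg _).trans (hgK 1 one_pos)
    exact nonneg_of_mul_nonneg_left this (by positivity)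
  have hexp : IntegrableOn (fun s : ℝ => K * L * Real.exp (-(1 / 2) * s)) (Ioi 0) :=
    (exp_neg_integrableOn_Ioi 0 (by norm_num : (0 : ℝ) < 1 / 2)).const_mul _
  refine Integrable.mono' hexp (by fun_prop) ?_
  filter_upwards [ae_restrict_mem measurableSet_Ioi] with s hs
  have hs : 0 < s := hs
  rw [Real.norm_eq_abs, abs_mul, Real.abs_exp]
  calc |g s| * Real.exp (-s) ≤ (K * (L * Real.exp (s / 2))) * Real.exp (-s) := by
        gcongr
        exact (hgK s hs).trans (by gcongr; exact hL s hs.le)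
    _ = K * L * Real.exp (-(1 / 2) * s) := by
        rw [show -(1 / 2) * s = s / 2 + -s by ring, Real.exp_add]; ring

theorem integral_exp_neg_Ioi_eq_one : ∫ s in Ioi (0 : ℝ), Real.exp (-s) = 1 := by
  rw [integral_exp_neg_Ioi]; simp

theorem integral_sub_one_mul_exp_neg :
    ∫ s in Ioi (0 : ℝ), (s - 1) * Real.exp (-s) = 0 := by
  have h := integral_Ioi_of_hasDerivAt_of_tendsto' (a := (0 : ℝ))
    (f := fun s => -s * Real.exp (-s)) (f' := fun s => (s - 1) * Real.exp (-s)) (m := 0)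
    (fun s _ => by
      have h1 : HasDerivAt (fun s : ℝ => Real.exp (-s)) (Real.exp (-s) * -1) s :=
        (hasDerivAt_neg s).exp
      exact ((hasDerivAt_neg s).mul h1).congr_deriv (by ring))
    (integrableOn_mul_exp_neg_of_le (K := 1) (q := 1) (by fun_prop) zero_le_one (by
      intro s hs
      rw [Real.rpow_one, abs_le]; constructor <;> linarith))
    (by
      have := (Real.tendsto_pow_mul_exp_neg_atTop_nhds_zero 1).neg
      simpa using this)
  simpa using h

/-- The substitution `x = a * exp (-s)`. -/
theorem image_mul_exp_neg {a : ℝ} (ha : 0 < a) :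
    (fun s => a * Real.exp (-s)) '' Ioi 0 = Ioo 0 a := by
  ext x
  constructor
  · rintro ⟨s, hs, rfl⟩
    have hs : 0 < s := hs
    refine ⟨by positivity, ?_⟩
    have : Real.exp (-s) < 1 := by simpa using hs
    nlinarith
  · rintro ⟨h0, h1⟩
    refine ⟨Real.log (a / x), Real.log_pos (by rwa [one_lt_div h0]), ?_⟩
    dsimp only
    rw [← Real.log_inv, Real.exp_log (by positivity)]
    field_simp

theorem hasDerivWithinAt_mul_exp_neg (a s : ℝ) (t : Set ℝ) :
    HasDerivWithinAt (fun s => a * Real.exp (-s)) (-(a * Real.exp (-s))) t s := by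
  have h1 : HasDerivAt (fun s : ℝ => Real.exp (-s)) (Real.exp (-s) * -1) s :=
    (hasDerivAt_neg s).exp
  exact ((h1.const_mul a).congr_deriv (by ring)).hasDerivWithinAt

theorem injOn_mul_exp_neg {a : ℝ} (ha : 0 < a) :
    InjOn (fun s => a * Real.exp (-s)) (Ioi 0) := by
  intro s _ t _ h
  have := Real.exp_injective (mul_left_cancel₀ ha.ne' h)
  linarith

theorem log_div_mul_exp_neg {a : ℝ} (ha : 0 < a) (s : ℝ) :
    Real.log (a / (a * Real.exp (-s))) = s := by
  rw [← div_div, div_self ha.ne', one_div, ← Real.exp_neg, Real.log_exp, neg_neg]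

theorem abs_neg_mul_exp_neg_smul {a : ℝ} (ha : 0 < a) (g : ℝ → ℝ) (s : ℝ) :
    |-(a * Real.exp (-s))| • g (Real.log (a / (a * Real.exp (-s)))) =
      a * (g s * Real.exp (-s)) := by
  rw [log_div_mul_exp_neg ha, abs_neg, abs_of_nonneg (by positivity), smul_eq_mul]
  ring

theorem integrableOn_comp_log_div {a : ℝ} (ha : 0 < a) {g : ℝ → ℝ}
    (hg : IntegrableOn (fun s => g s * Real.exp (-s)) (Ioi 0)) :
    IntegrableOn (fun x => g (Real.log (a / x))) (Ioo 0 a) := by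
  rw [← image_mul_exp_neg ha, integrableOn_image_iff_integrableOn_abs_deriv_smul
    measurableSet_Ioi (fun s _ => hasDerivWithinAt_mul_exp_neg a s _) (injOn_mul_exp_neg ha)]
  simp only [abs_neg_mul_exp_neg_smul ha]
  exact hg.const_mul a

theorem integral_comp_log_div {a : ℝ} (ha : 0 < a) (g : ℝ → ℝ) :
    ∫ x in Ioo 0 a, g (Real.log (a / x)) = a * ∫ s in Ioi 0, g s * Real.exp (-s) := by
  rw [← image_mul_exp_neg ha, integral_image_eq_integral_abs_deriv_smul
    measurableSet_Ioi (fun s _ => hasDerivWithinAt_mul_exp_neg a s _) (injOn_mul_exp_neg ha)]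
  simp only [abs_neg_mul_exp_neg_smul ha]
  exact integral_const_mul _ _

theorem hardyC_eq_integral_exp (p : ℝ) :
    hardyC p = ∫ s in Ioi (0 : ℝ), |s - 1| ^ p * Real.exp (-s) := by
  have h := integral_comp_log_div one_pos (fun s => |s - 1| ^ p)
  rw [one_mul] at h
  rw [← h, hardyC, intervalIntegral.integral_of_le zero_le_one, integral_Ioc_eq_integral_Ioo]
  refine setIntegral_congr_fun measurableSet_Ioo fun x hx => ?_
  simp only [one_div, Real.log_inv]
  rw [← abs_neg]; congr 2; ring

/-! ### The pointwise inequality behind the constant `p - 1` -/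

theorem hasDerivAt_pow_diff {p : ℝ} (hp : 1 < p) (K D : ℝ) {a : ℝ} (ha : 0 < a)
    (hm : 0 < (a + (p - 1) * D) / p) :
    HasDerivAt (fun a => K - a ^ p - p * (D - a) * ((a + (p - 1) * D) / p) ^ (p - 1))
      (p * a * (((a + (p - 1) * D) / p) ^ (p - 2) - a ^ (p - 2))) a := by
  have hp0 : p ≠ 0 := by linarith
  have h1 : HasDerivAt (fun a : ℝ => a ^ p) (p * a ^ (p - 1)) a :=
    Real.hasDerivAt_rpow_const (Or.inl ha.ne')
  have h2 : HasDerivAt (fun a : ℝ => (a + (p - 1) * D) / p) (1 / p) a :=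
    ((hasDerivAt_id a).add_const _).div_const p
  have h3 := h2.rpow_const (p := p - 1) (Or.inl hm.ne')
  have h4 : HasDerivAt (fun a : ℝ => p * (D - a)) (p * -1) a :=
    ((hasDerivAt_id a).const_sub D).const_mul p
  refine ((h1.const_sub K).sub (h4.mul h3)).congr_deriv ?_
  set m := (a + (p - 1) * D) / p with hmdef
  have e1 : m ^ (p - 1) = m ^ (p - 2) * m := by
    rw [show p - 1 = (p - 2) + 1 by ring, Real.rpow_add_one hm.ne']
  have e2 : a ^ (p - 1) = a ^ (p - 2) * a := by
    rw [show p - 1 = (p - 2) + 1 by ring, Real.rpow_add_one ha.ne']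
  rw [show p - 1 - 1 = p - 2 by ring, e1, e2]
  have hD : p * m = a + (p - 1) * D := by rw [hmdef]; field_simp
  have e3 : p * (D - a) * (1 / p * (p - 1) * m ^ (p - 2)) = (p * m - p * a) * m ^ (p - 2) := by
    rw [hD]; field_simp; ring
  rw [e3]; ring

theorem continuous_pow_diff {p : ℝ} (hp : 1 < p) (K D : ℝ) :
    Continuous (fun a => K - a ^ p - p * (D - a) * ((a + (p - 1) * D) / p) ^ (p - 1)) := by
  have h1 : Continuous (fun a : ℝ => a ^ p) := Real.continuous_rpow_const (by linarith)
  have h2 : Continuous (fun a : ℝ => ((a + (p - 1) * D) / p) ^ (p - 1)) :=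
    (Real.continuous_rpow_const (by linarith : (0:ℝ) ≤ p - 1)).comp (by fun_prop)
  fun_prop

/-- For `p ≥ 2`, the tangent-line inequality at `D = a`. -/
theorem rpow_sub_rpow_le_of_two_le {p a D : ℝ} (hp : 2 ≤ p) (ha : 0 ≤ a) (hD : 0 ≤ D) :
    D ^ p - a ^ p - p * (D - a) * ((a + (p - 1) * D) / p) ^ (p - 1) ≤ 0 := by
  set N : ℝ → ℝ := fun a => D ^ p - a ^ p - p * (D - a) * ((a + (p - 1) * D) / p) ^ (p - 1)
    with hN
  have hND : N D = 0 := by simp [hN]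
  have hp1 : 1 < p := by linarith
  have hp0 : 0 < p := by linarith
  have hc : Continuous N := continuous_pow_diff hp1 _ D
  have hd : ∀ a, 0 < a → HasDerivAt N
      (p * a * (((a + (p - 1) * D) / p) ^ (p - 2) - a ^ (p - 2))) a := fun a ha =>
    hasDerivAt_pow_diff hp1 _ D ha
      (div_pos (add_pos_of_pos_of_nonneg ha (mul_nonneg (by linarith) hD)) hp0)
  change N a ≤ 0
  rw [← hND]
  rcases le_total a D with h | h
  · have hmono : MonotoneOn N (Icc 0 D) := by
      refine monotoneOn_of_deriv_nonneg (convex_Icc 0 D) hc.continuousOn ?_ ?_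
      · rw [interior_Icc]
        exact fun x hx => (hd x hx.1).differentiableAt.differentiableWithinAt
      · rw [interior_Icc]
        intro x hx
        rw [(hd x hx.1).deriv]
        refine mul_nonneg (mul_nonneg hp0.le hx.1.le) (sub_nonneg.2 ?_)
        refine Real.rpow_le_rpow hx.1.le ?_ (by linarith)
        rw [le_div_iff₀ hp0]; nlinarith [hx.2]
    exact hmono ⟨ha, h⟩ ⟨hD, le_rfl⟩ h
  · have hanti : AntitoneOn N (Ici D) := by
      refine antitoneOn_of_deriv_nonpos (convex_Ici D) hc.continuousOn ?_ ?_
      · rw [interior_Ici]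
        exact fun x hx => (hd x (hD.trans_lt hx)).differentiableAt.differentiableWithinAt
      · rw [interior_Ici]
        intro x hx
        have hx : D < x := hx
        have hx0 : 0 < x := hD.trans_lt hx
        rw [(hd x hx0).deriv]
        refine mul_nonpos_of_nonneg_of_nonpos (mul_nonneg hp0.le hx0.le) (sub_nonpos.2 ?_)
        refine Real.rpow_le_rpow (div_nonneg (by nlinarith) hp0.le) ?_ (by linarith)
        rw [div_le_iff₀ hp0]; nlinarith
    exact hanti (mem_Ici.2 le_rfl) (mem_Ici.2 h) h

theorem rpow_sub_rpow_nonneg_of_le_two {p a D : ℝ} (hp1 : 1 < p) (hp : p ≤ 2) (ha : 0 ≤ a)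
    (hD : 0 ≤ D) :
    0 ≤ D ^ p - a ^ p - p * (D - a) * ((a + (p - 1) * D) / p) ^ (p - 1) := by
  set N : ℝ → ℝ := fun a => D ^ p - a ^ p - p * (D - a) * ((a + (p - 1) * D) / p) ^ (p - 1)
    with hN
  have hND : N D = 0 := by simp [hN]
  have hp0 : 0 < p := by linarith
  have hc : Continuous N := continuous_pow_diff hp1 _ D
  have hd : ∀ a, 0 < a → HasDerivAt N
      (p * a * (((a + (p - 1) * D) / p) ^ (p - 2) - a ^ (p - 2))) a := fun a ha =>
    hasDerivAt_pow_diff hp1 _ D ha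
      (div_pos (add_pos_of_pos_of_nonneg ha (mul_nonneg (by linarith) hD)) hp0)
  change 0 ≤ N a
  rw [← hND]
  rcases le_total a D with h | h
  · have hanti : AntitoneOn N (Icc 0 D) := by
      refine antitoneOn_of_deriv_nonpos (convex_Icc 0 D) hc.continuousOn ?_ ?_
      · rw [interior_Icc]
        exact fun x hx => (hd x hx.1).differentiableAt.differentiableWithinAt
      · rw [interior_Icc]
        intro x hx
        rw [(hd x hx.1).deriv]
        refine mul_nonpos_of_nonneg_of_nonpos (mul_nonneg hp0.le hx.1.le) (sub_nonpos.2 ?_)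
        refine Real.rpow_le_rpow_of_nonpos hx.1 ?_ (by linarith)
        rw [le_div_iff₀ hp0]; nlinarith [hx.2]
    exact hanti ⟨ha, h⟩ ⟨hD, le_rfl⟩ h
  · have hmono : MonotoneOn N (Ici D) := by
      refine monotoneOn_of_deriv_nonneg (convex_Ici D) hc.continuousOn ?_ ?_
      · rw [interior_Ici]
        exact fun x hx => (hd x (hD.trans_lt hx)).differentiableAt.differentiableWithinAt
      · rw [interior_Ici]
        intro x hx
        have hx : D < x := hx
        have hx0 : 0 < x := hD.trans_lt hx
        rw [(hd x hx0).deriv]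
        refine mul_nonneg (mul_nonneg hp0.le hx0.le) (sub_nonneg.2 ?_)
        refine Real.rpow_le_rpow_of_nonpos
          (div_pos (add_pos_of_pos_of_nonneg hx0 (mul_nonneg (by linarith) hD)) hp0) ?_
          (by linarith)
        rw [div_le_iff₀ hp0]; nlinarith
    exact hmono (mem_Ici.2 le_rfl) (mem_Ici.2 h) h

/-- The analogue of `rpow_sub_rpow_le_of_two_le` with `D = -e` negative. -/
theorem rpow_sub_rpow_neg_le_of_two_le {p a e : ℝ} (hp : 2 ≤ p) (he : 0 ≤ e)
    (hea : (p - 1) * e ≤ a) :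
    e ^ p - a ^ p - p * (-e - a) * ((a + (p - 1) * -e) / p) ^ (p - 1) ≤ 0 := by
  set N : ℝ → ℝ := fun a => e ^ p - a ^ p - p * (-e - a) * ((a + (p - 1) * -e) / p) ^ (p - 1)
    with hN
  have hp1 : 1 < p := by linarith
  have hp0 : 0 < p := by linarith
  have he' : 0 ≤ (p - 1) * e := mul_nonneg (by linarith) he
  have hN0 : N ((p - 1) * e) ≤ 0 := by
    have : e ^ p ≤ ((p - 1) * e) ^ p := Real.rpow_le_rpow he (by nlinarith) hp0.le
    simpa [hN, Real.zero_rpow (by linarith : p - 1 ≠ 0)] using this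
  have hc : Continuous N := continuous_pow_diff hp1 _ _
  have hanti : AntitoneOn N (Ici ((p - 1) * e)) := by
    have hd : ∀ x ∈ Ioi ((p - 1) * e), HasDerivAt N _ x := fun x hx =>
      hasDerivAt_pow_diff hp1 _ (-e) (he'.trans_lt hx)
        (div_pos (by have : (p - 1) * e < x := hx
                     linarith) hp0)
    refine antitoneOn_of_deriv_nonpos (convex_Ici _) hc.continuousOn ?_ ?_
    · rw [interior_Ici]
      exact fun x hx => (hd x hx).differentiableAt.differentiableWithinAt
    · rw [interior_Ici]
      intro x hx
      rw [(hd x hx).deriv]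
      have hx : (p - 1) * e < x := hx
      have hx0 : 0 < x := he'.trans_lt hx
      refine mul_nonpos_of_nonneg_of_nonpos (mul_nonneg hp0.le hx0.le) (sub_nonpos.2 ?_)
      refine Real.rpow_le_rpow (div_nonneg (by linarith) hp0.le) ?_ (by linarith)
      rw [div_le_iff₀ hp0]; nlinarith
  exact (hanti (mem_Ici.2 le_rfl) (mem_Ici.2 hea) hea).trans hN0

theorem rpow_sub_rpow_neg_nonneg_of_le_two {p a e : ℝ} (hp1 : 1 < p) (hp : p ≤ 2) (he : 0 ≤ e)
    (hea : (p - 1) * e ≤ a) :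
    0 ≤ e ^ p - a ^ p - p * (-e - a) * ((a + (p - 1) * -e) / p) ^ (p - 1) := by
  set N : ℝ → ℝ := fun a => e ^ p - a ^ p - p * (-e - a) * ((a + (p - 1) * -e) / p) ^ (p - 1)
    with hN
  have hp0 : 0 < p := by linarith
  have he' : 0 ≤ (p - 1) * e := mul_nonneg (by linarith) he
  have hN0 : 0 ≤ N ((p - 1) * e) := by
    have : ((p - 1) * e) ^ p ≤ e ^ p := Real.rpow_le_rpow he' (by nlinarith) hp0.le
    simpa [hN, Real.zero_rpow (by linarith : p - 1 ≠ 0)] using this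
  have hc : Continuous N := continuous_pow_diff hp1 _ _
  have hmono : MonotoneOn N (Ici ((p - 1) * e)) := by
    have hpos : ∀ x ∈ Ioi ((p - 1) * e), 0 < (x + (p - 1) * -e) / p := fun x hx =>
      div_pos (by have : (p - 1) * e < x := hx
                  linarith) hp0
    have hd : ∀ x ∈ Ioi ((p - 1) * e), HasDerivAt N _ x := fun x hx =>
      hasDerivAt_pow_diff hp1 _ (-e) (he'.trans_lt hx) (hpos x hx)
    refine monotoneOn_of_deriv_nonneg (convex_Ici _) hc.continuousOn ?_ ?_
    · rw [interior_Ici]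
      exact fun x hx => (hd x hx).differentiableAt.differentiableWithinAt
    · rw [interior_Ici]
      intro x hx
      rw [(hd x hx).deriv]
      have hm := hpos x hx
      have hx : (p - 1) * e < x := hx
      have hx0 : 0 < x := he'.trans_lt hx
      refine mul_nonneg (mul_nonneg hp0.le hx0.le) (sub_nonneg.2 ?_)
      refine Real.rpow_le_rpow_of_nonpos hm ?_ (by linarith)
      rw [div_le_iff₀ hp0]; nlinarith
  exact hN0.trans (hmono (mem_Ici.2 le_rfl) (mem_Ici.2 hea) hea)

noncomputable section

/-- The slope of the tangent line in the pointwise inequality, so chosen that both sides agree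
to first order at `F = p * f`, the ratio `H* f / f` of the critical power `x ^ (-1 / p)`. -/
def tangentSlope (p : ℝ) : ℝ := p * ((p - 1) / p) ^ (p - 1)

end

theorem tangentSlope_mul {p F f : ℝ} (hp : 1 < p) (hF : 0 ≤ F) :
    tangentSlope p * (F ^ p - p * F ^ (p - 1) * f) =
      p * (F - f - (p - 1) * f) * (((p - 1) * f + (p - 1) * (F - f)) / p) ^ (p - 1) := by
  have e : ((p - 1) * f + (p - 1) * (F - f)) / p = (p - 1) / p * F := by ring
  have e1 : F ^ p = F ^ (p - 1) * F := by
    rw [← Real.rpow_add_one' hF (by linarith)]; ring_nf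
  rw [e, Real.mul_rpow (div_nonneg (by linarith) (by linarith)) hF, e1, tangentSlope]
  ring

theorem abs_sub_rpow_sub_le_of_two_le {p F f : ℝ} (hp : 2 ≤ p) (hF : 0 ≤ F) (hf : 0 ≤ f) :
    |F - f| ^ p - ((p - 1) * f) ^ p ≤ tangentSlope p * (F ^ p - p * F ^ (p - 1) * f) := by
  rw [tangentSlope_mul (by linarith) hF]
  rcases le_total f F with h | h
  · rw [abs_of_nonneg (sub_nonneg.2 h)]
    linarith [rpow_sub_rpow_le_of_two_le hp (mul_nonneg (by linarith : 0 ≤ p - 1) hf)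
      (sub_nonneg.2 h)]
  · rw [abs_of_nonpos (sub_nonpos.2 h)]
    have := rpow_sub_rpow_neg_le_of_two_le (a := (p - 1) * f) (e := -(F - f)) hp (by linarith)
      (by nlinarith)
    rw [neg_neg] at this
    linarith

theorem le_abs_sub_rpow_sub_of_le_two {p F f : ℝ} (hp1 : 1 < p) (hp : p ≤ 2) (hF : 0 ≤ F)
    (hf : 0 ≤ f) :
    tangentSlope p * (F ^ p - p * F ^ (p - 1) * f) ≤ |F - f| ^ p - ((p - 1) * f) ^ p := by
  rw [tangentSlope_mul hp1 hF]
  rcases le_total f F with h | h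
  · rw [abs_of_nonneg (sub_nonneg.2 h)]
    linarith [rpow_sub_rpow_nonneg_of_le_two hp1 hp (mul_nonneg (by linarith : 0 ≤ p - 1) hf)
      (sub_nonneg.2 h)]
  · rw [abs_of_nonpos (sub_nonpos.2 h)]
    have := rpow_sub_rpow_neg_nonneg_of_le_two (a := (p - 1) * f) (e := -(F - f)) hp1 hp
      (by linarith) (by nlinarith)
    rw [neg_neg] at this
    linarith

/-! ### A sign lemma for the exponential distribution -/

theorem mul_exp_neg_le_mul_exp {y z : ℝ} (h : y ≤ z) : y * Real.exp (-y) ≤ z * Real.exp z := by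
  rcases le_total 0 z with hz | hz
  · rcases le_total y 0 with hy | hy
    · exact (mul_nonpos_of_nonpos_of_nonneg hy (Real.exp_pos _).le).trans
        (mul_nonneg hz (Real.exp_pos _).le)
    · exact mul_le_mul h (Real.exp_le_exp.2 (by linarith)) (Real.exp_pos _).le hz
  · have := mul_le_mul (neg_le_neg h) (Real.exp_le_exp.2 (by linarith : z ≤ -y))
      (Real.exp_pos _).le (by linarith)
    linarith

/-- If `κ` is nonincreasing on `[0, ∞)`, then `s - 1` and `κ |b (s - 1) + c|` are negatively
correlated under the exponential distribution: after folding the half-line at the symmetry point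
of `|b (s - 1) + c|`, the signed density `(s - 1) exp (-s)` changes sign only once. -/
theorem integral_sub_one_mul_comp_abs_nonpos {κ : ℝ → ℝ} (hκ : AntitoneOn κ (Ici 0)) {b c : ℝ}
    (hb : 0 < b) (hc : 0 ≤ c)
    (hint : IntegrableOn (fun s => (s - 1) * κ |b * (s - 1) + c| * Real.exp (-s)) (Ioi 0)) :
    ∫ s in Ioi (0 : ℝ), (s - 1) * κ |b * (s - 1) + c| * Real.exp (-s) ≤ 0 := by
  have hlin : IntegrableOn (fun s : ℝ => (s - 1) * Real.exp (-s)) (Ioi 0) :=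
    integrableOn_mul_exp_neg_of_le (K := 1) (q := 1) (by fun_prop) zero_le_one (by
      intro s hs
      rw [Real.rpow_one, abs_le]; constructor <;> linarith)
  -- Subtracting a constant from `κ` does not change the integral.
  have hshift : ∀ k : ℝ,
      IntegrableOn (fun s => (s - 1) * (κ |b * (s - 1) + c| - k) * Real.exp (-s)) (Ioi 0) ∧
      ∫ s in Ioi (0 : ℝ), (s - 1) * κ |b * (s - 1) + c| * Real.exp (-s) =
        ∫ s in Ioi (0 : ℝ), (s - 1) * (κ |b * (s - 1) + c| - k) * Real.exp (-s) := by
    intro k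
    have e : (fun s => (s - 1) * (κ |b * (s - 1) + c| - k) * Real.exp (-s)) =
        fun s => (s - 1) * κ |b * (s - 1) + c| * Real.exp (-s)
          - k * ((s - 1) * Real.exp (-s)) := by
      funext s; ring
    rw [e]
    refine ⟨hint.sub (hlin.const_mul k), ?_⟩
    rw [integral_sub hint (hlin.const_mul k), integral_const_mul, integral_sub_one_mul_exp_neg]
    simp
  have hle : ∀ {u v : ℝ}, |u| ≤ |v| → κ |v| ≤ κ |u| := fun h =>
    hκ (mem_Ici.2 (abs_nonneg _)) (mem_Ici.2 (abs_nonneg _)) h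
  -- If the symmetry point `1 - c / b` is at most `1 / 2`, then on the half-line
  -- `|b (s - 1) + c| ≤ c` means `s ≤ 1`, and comparison with `κ c` makes the integrand nonpositive without any folding.
  rcases le_or_gt b (2 * c) with hbc | hbc
  · rw [(hshift (κ |c|)).2]
    refine setIntegral_nonpos measurableSet_Ioi fun s hs => ?_
    have hs : 0 < s := hs
    refine mul_nonpos_of_nonpos_of_nonneg ?_ (Real.exp_pos _).le
    rcases le_total 1 s with h | h
    · refine mul_nonpos_of_nonneg_of_nonpos (by linarith) (sub_nonpos.2 (hle ?_))
      have : 0 ≤ b * (s - 1) := mul_nonneg hb.le (by linarith)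
      rw [abs_of_nonneg hc, abs_of_nonneg (by linarith)]; linarith
    · refine mul_nonpos_of_nonpos_of_nonneg (by linarith) (sub_nonneg.2 (hle ?_))
      rw [abs_of_nonneg hc, abs_le]
      constructor <;> nlinarith
  · -- `T` is the reflection of the endpoint `0`; the folded density changes sign there.
    set T : ℝ := 2 - 2 * c / b with hT
    have hT1 : 1 < T := by
      have : 2 * c / b < 1 := by rwa [div_lt_one hb]
      linarith
    have hbT : b * T = 2 * b - 2 * c := by rw [hT]; field_simp
    obtain ⟨hi, he⟩ := hshift (κ |c - b|)
    rw [he, ← Ioc_union_Ioi_eq_Ioi (by linarith : (0 : ℝ) ≤ T),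
      setIntegral_union (Ioc_disjoint_Ioi le_rfl) measurableSet_Ioi
        (hi.mono_set Ioc_subset_Ioi_self) (hi.mono_set (Ioi_subset_Ioi (by linarith)))]
    refine add_nonpos ?_ ?_
    · rw [← intervalIntegral.integral_of_le (by linarith)]
      set g : ℝ → ℝ := fun s => (s - 1) * (κ |b * (s - 1) + c| - κ |c - b|) * Real.exp (-s)
      have hgi : IntervalIntegrable g volume 0 T :=
        (intervalIntegrable_iff_integrableOn_Ioc_of_le (by linarith)).2
          (hi.mono_set Ioc_subset_Ioi_self)
      have hrefl : ∫ s in (0 : ℝ)..T, g (T - s) = ∫ s in (0 : ℝ)..T, g s := by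
        simp [intervalIntegral.integral_comp_sub_left]
      have hgi' : IntervalIntegrable (fun s => g (T - s)) volume 0 T := by
        have := (hgi.comp_sub_left T).symm
        simpa using this
      have hsum : ∫ s in (0 : ℝ)..T, (g s + g (T - s)) ≤ 0 := by
        rw [intervalIntegral.integral_of_le (by linarith)]
        refine setIntegral_nonpos measurableSet_Ioc fun s hs => ?_
        have e1 : b * (T - s - 1) + c = -(b * (s - 1) + c) := by linarith
        have e2 : g s + g (T - s) = (κ |b * (s - 1) + c| - κ |c - b|) *
            ((s - 1) * Real.exp (-s) + (T - s - 1) * Real.exp (-(T - s))) := by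
          simp only [g, e1, abs_neg]; ring
        rw [e2]
        refine mul_nonpos_of_nonneg_of_nonpos (sub_nonneg.2 (hle ?_)) ?_
        · have : b * s ≤ b * T := mul_le_mul_of_nonneg_left hs.2 hb.le
          have : 0 < b * s := mul_pos hb hs.1
          rw [abs_of_nonpos (by linarith : c - b ≤ 0), abs_le]
          constructor <;> linarith
        · have hyz : s - 1 ≤ -(T - s - 1) := by
            have : 0 ≤ 2 * c / b := by positivity
            linarith
          have h := mul_exp_neg_le_mul_exp hyz
          have e3 : Real.exp (-s) = Real.exp (-(s - 1)) * Real.exp (-1) := by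
            rw [← Real.exp_add]; ring_nf
          have e4 : Real.exp (-(T - s)) = Real.exp (-(T - s - 1)) * Real.exp (-1) := by
            rw [← Real.exp_add]; ring_nf
          rw [e3, e4, ← mul_assoc, ← mul_assoc, ← add_mul]
          exact mul_nonpos_of_nonpos_of_nonneg (by linarith) (Real.exp_pos _).le
      rw [intervalIntegral.integral_add hgi hgi', hrefl] at hsum
      linarith
    · refine setIntegral_nonpos measurableSet_Ioi fun s hs => ?_
      have hs : T < s := hs
      refine mul_nonpos_of_nonpos_of_nonneg ?_ (Real.exp_pos _).le
      refine mul_nonpos_of_nonneg_of_nonpos (by linarith) (sub_nonpos.2 (hle ?_))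
      have : b * T < b * s := mul_lt_mul_of_pos_left hs hb
      rw [abs_of_nonpos (by linarith : c - b ≤ 0), abs_of_nonneg (by linarith)]
      linarith

/-! ### Differences of signed powers -/

noncomputable section

/-- The odd power `|t| ^ (p - 2) * t`, of degree `p - 1`; up to the factor `p` it is the derivative
of `|t| ^ p`. -/
def signedPow (p t : ℝ) : ℝ := |t| ^ (p - 2) * t

end

theorem signedPow_neg (p t : ℝ) : signedPow p (-t) = -signedPow p t := by
  simp [signedPow]

theorem signedPow_of_nonneg {p t : ℝ} (hp : 1 < p) (ht : 0 ≤ t) :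
    signedPow p t = t ^ (p - 1) := by
  rw [signedPow, abs_of_nonneg ht, show p - 1 = (p - 2) + 1 by ring,
    Real.rpow_add_one' ht (by linarith)]

theorem abs_signedPow {p : ℝ} (hp : 1 < p) (t : ℝ) : |signedPow p t| = |t| ^ (p - 1) := by
  rw [← signedPow_of_nonneg hp (abs_nonneg t), signedPow, signedPow, abs_mul, abs_abs,
    abs_of_nonneg (Real.rpow_nonneg (abs_nonneg t) _)]

@[fun_prop]
theorem measurable_signedPow (p : ℝ) : Measurable (signedPow p) := by
  unfold signedPow; fun_prop

theorem signedPow_add_sub_abs (p c u : ℝ) :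
    signedPow p (u + c) - signedPow p (u - c) =
      signedPow p (|u| + c) - signedPow p (|u| - c) := by
  rcases le_total 0 u with h | h
  · rw [abs_of_nonneg h]
  · rw [abs_of_nonpos h, show -u + c = -(u - c) by ring, show -u - c = -(u + c) by ring,
      signedPow_neg, signedPow_neg]
    ring

theorem hasDerivAt_signedPow_add_sub {p c t : ℝ} (ht : 0 < t) (htc : t < c) :
    HasDerivAt (fun t => (t + c) ^ (p - 1) + (c - t) ^ (p - 1))
      ((p - 1) * ((t + c) ^ (p - 2) - (c - t) ^ (p - 2))) t := by
  have h1 := ((hasDerivAt_id t).add_const c).rpow_const (p := p - 1)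
    (Or.inl (by simp only [id]; linarith))
  have h2 := ((hasDerivAt_id t).const_sub c).rpow_const (p := p - 1)
    (Or.inl (by simp only [id]; linarith))
  refine (h1.add h2).congr_deriv ?_
  simp only [id, show p - 1 - 1 = p - 2 by ring]
  ring

theorem hasDerivAt_signedPow_add_sub' {p c t : ℝ} (hc : 0 ≤ c) (htc : c < t) :
    HasDerivAt (fun t => (t + c) ^ (p - 1) - (t - c) ^ (p - 1))
      ((p - 1) * ((t + c) ^ (p - 2) - (t - c) ^ (p - 2))) t := by
  have h1 := ((hasDerivAt_id t).add_const c).rpow_const (p := p - 1)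
    (Or.inl (by simp only [id]; linarith))
  have h2 := ((hasDerivAt_id t).sub_const c).rpow_const (p := p - 1)
    (Or.inl (by simp only [id]; linarith))
  refine (h1.sub h2).congr_deriv ?_
  simp only [id, show p - 1 - 1 = p - 2 by ring]
  ring

theorem eqOn_signedPow_add_sub {p c : ℝ} (hp : 1 < p) :
    EqOn (fun t => (t + c) ^ (p - 1) + (c - t) ^ (p - 1))
      (fun t => signedPow p (t + c) - signedPow p (t - c)) (Icc 0 c) := by
  intro t ht
  dsimp only
  rw [signedPow_of_nonneg hp (by linarith [ht.1, ht.2]), show t - c = -(c - t) by ring,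
    signedPow_neg, signedPow_of_nonneg hp (by linarith [ht.1, ht.2])]
  ring

theorem eqOn_signedPow_add_sub' {p c : ℝ} (hp : 1 < p) (hc : 0 ≤ c) :
    EqOn (fun t => (t + c) ^ (p - 1) - (t - c) ^ (p - 1))
      (fun t => signedPow p (t + c) - signedPow p (t - c)) (Ici c) := by
  intro t ht
  have ht : c ≤ t := ht
  dsimp only
  rw [signedPow_of_nonneg hp (by linarith [hc]), signedPow_of_nonneg hp (by linarith)]

theorem continuous_add_rpow_add {p : ℝ} (hp : 1 < p) (c : ℝ) :
    Continuous (fun t : ℝ => (t + c) ^ (p - 1) + (c - t) ^ (p - 1)) := by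
  have h := Real.continuous_rpow_const (by linarith : (0:ℝ) ≤ p - 1)
  exact (h.comp (by fun_prop)).add (h.comp (by fun_prop))

theorem continuous_add_rpow_sub {p : ℝ} (hp : 1 < p) (c : ℝ) :
    Continuous (fun t : ℝ => (t + c) ^ (p - 1) - (t - c) ^ (p - 1)) := by
  have h := Real.continuous_rpow_const (by linarith : (0:ℝ) ≤ p - 1)
  exact (h.comp (by fun_prop)).sub (h.comp (by fun_prop))

theorem antitoneOn_signedPow_add_sub {p c : ℝ} (hp : 1 < p) (hp2 : p ≤ 2) (hc : 0 ≤ c) :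
    AntitoneOn (fun t => signedPow p (t + c) - signedPow p (t - c)) (Ici 0) := by
  rw [← Icc_union_Ici_eq_Ici hc]
  refine AntitoneOn.union_right (c := c) ?_ ?_ (isGreatest_Icc hc) isLeast_Ici
  · refine AntitoneOn.congr ?_ (eqOn_signedPow_add_sub hp)
    refine antitoneOn_of_deriv_nonpos (convex_Icc 0 c)
      (continuous_add_rpow_add hp c).continuousOn ?_ ?_ <;> rw [interior_Icc]
    · exact fun t ht =>
        (hasDerivAt_signedPow_add_sub ht.1 ht.2).differentiableAt.differentiableWithinAt
    · intro t ht
      rw [(hasDerivAt_signedPow_add_sub ht.1 ht.2).deriv]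
      exact mul_nonpos_of_nonneg_of_nonpos (by linarith) (sub_nonpos.2
        (Real.rpow_le_rpow_of_nonpos (by linarith [ht.2]) (by linarith [ht.1]) (by linarith)))
  · refine AntitoneOn.congr ?_ (eqOn_signedPow_add_sub' hp hc)
    refine antitoneOn_of_deriv_nonpos (convex_Ici c)
      (continuous_add_rpow_sub hp c).continuousOn ?_ ?_ <;> rw [interior_Ici]
    · exact fun t ht =>
        (hasDerivAt_signedPow_add_sub' hc ht).differentiableAt.differentiableWithinAt
    · intro t ht
      rw [(hasDerivAt_signedPow_add_sub' hc ht).deriv]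
      have ht : c < t := ht
      exact mul_nonpos_of_nonneg_of_nonpos (by linarith) (sub_nonpos.2
        (Real.rpow_le_rpow_of_nonpos (by linarith) (by linarith) (by linarith)))

theorem monotoneOn_signedPow_add_sub {p c : ℝ} (hp2 : 2 ≤ p) (hc : 0 ≤ c) :
    MonotoneOn (fun t => signedPow p (t + c) - signedPow p (t - c)) (Ici 0) := by
  have hp : 1 < p := by linarith
  rw [← Icc_union_Ici_eq_Ici hc]
  refine MonotoneOn.union_right (c := c) ?_ ?_ (isGreatest_Icc hc) isLeast_Ici
  · refine MonotoneOn.congr ?_ (eqOn_signedPow_add_sub hp)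
    refine monotoneOn_of_deriv_nonneg (convex_Icc 0 c)
      (continuous_add_rpow_add hp c).continuousOn ?_ ?_ <;> rw [interior_Icc]
    · exact fun t ht =>
        (hasDerivAt_signedPow_add_sub ht.1 ht.2).differentiableAt.differentiableWithinAt
    · intro t ht
      rw [(hasDerivAt_signedPow_add_sub ht.1 ht.2).deriv]
      exact mul_nonneg (by linarith) (sub_nonneg.2
        (Real.rpow_le_rpow (by linarith [ht.2]) (by linarith [ht.1]) (by linarith)))
  · refine MonotoneOn.congr ?_ (eqOn_signedPow_add_sub' hp hc)
    refine monotoneOn_of_deriv_nonneg (convex_Ici c)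
      (continuous_add_rpow_sub hp c).continuousOn ?_ ?_ <;> rw [interior_Ici]
    · exact fun t ht =>
        (hasDerivAt_signedPow_add_sub' hc ht).differentiableAt.differentiableWithinAt
    · intro t ht
      rw [(hasDerivAt_signedPow_add_sub' hc ht).deriv]
      have ht : c < t := ht
      exact mul_nonneg (by linarith) (sub_nonneg.2
        (Real.rpow_le_rpow (by linarith) (by linarith) (by linarith)))

/-! ### Monotonicity of exponential integrals in the slope -/

theorem abs_add_mul_sub_one_le {A b s : ℝ} (hs : 0 < s) :
    |A + b * (s - 1)| ≤ (|A| + |b|) * (1 + s) := by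
  have h1 : |s - 1| ≤ 1 + s := by rw [abs_le]; constructor <;> linarith
  calc |A + b * (s - 1)| ≤ |A| + |b| * |s - 1| := by
        rw [← abs_mul]; exact abs_add_le _ _
    _ ≤ |A| * (1 + s) + |b| * (1 + s) := by
        gcongr; nlinarith [abs_nonneg A]
    _ = _ := by ring

theorem abs_add_mul_sub_one_rpow_le {q A b s : ℝ} (hq : 0 ≤ q) (hs : 0 < s) :
    |A + b * (s - 1)| ^ q ≤ (|A| + |b|) ^ q * (1 + s) ^ q := by
  rw [← Real.mul_rpow (by positivity) (by positivity)]
  exact Real.rpow_le_rpow (abs_nonneg _) (abs_add_mul_sub_one_le hs) hq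

theorem integrableOn_abs_add_rpow {p : ℝ} (hp : 0 ≤ p) (A b : ℝ) :
    IntegrableOn (fun s => |A + b * (s - 1)| ^ p * Real.exp (-s)) (Ioi 0) := by
  refine integrableOn_mul_exp_neg_of_le (K := (|A| + |b|) ^ p) (q := p) (by fun_prop) hp ?_
  intro s hs
  rw [abs_of_nonneg (by positivity)]
  exact abs_add_mul_sub_one_rpow_le hp hs

theorem abs_sub_one_mul_signedPow_le {p A b s : ℝ} (hp : 1 < p) (hs : 0 < s) :
    |(s - 1) * signedPow p (A + b * (s - 1))| ≤ (|A| + |b|) ^ (p - 1) * (1 + s) ^ p := by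
  have h1 : |s - 1| ≤ 1 + s := by rw [abs_le]; constructor <;> linarith
  have e : (1 + s) ^ p = (1 + s) * (1 + s) ^ (p - 1) := by
    rw [← Real.rpow_one_add' (by positivity) (by linarith)]; ring_nf
  rw [abs_mul, abs_signedPow hp, e]
  calc |s - 1| * |A + b * (s - 1)| ^ (p - 1)
      ≤ (1 + s) * ((|A| + |b|) ^ (p - 1) * (1 + s) ^ (p - 1)) := by
        gcongr
        exact abs_add_mul_sub_one_rpow_le (by linarith) hs
    _ = _ := by ring

theorem integrableOn_sub_one_mul_signedPow {p : ℝ} (hp : 1 < p) (A b : ℝ) :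
    IntegrableOn (fun s => (s - 1) * signedPow p (A + b * (s - 1)) * Real.exp (-s)) (Ioi 0) :=
  integrableOn_mul_exp_neg_of_le (by fun_prop) (by linarith)
    fun _ hs => abs_sub_one_mul_signedPow_le hp hs

theorem hasDerivAt_integral_abs_add_rpow {p : ℝ} (hp : 1 < p) (A b : ℝ) :
    HasDerivAt (fun b => ∫ s in Ioi (0 : ℝ), |A + b * (s - 1)| ^ p * Real.exp (-s))
      (∫ s in Ioi (0 : ℝ), p * ((s - 1) * signedPow p (A + b * (s - 1)) * Real.exp (-s))) b := by
  have hbound : ∀ x ∈ Metric.ball b 1, ∀ s : ℝ, 0 < s →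
      |(s - 1) * signedPow p (A + x * (s - 1))| ≤ (|A| + (|b| + 1)) ^ (p - 1) * (1 + s) ^ p := by
    intro x hx s hs
    have hx' : |x| ≤ |b| + 1 := by
      have h1 : |x - b| < 1 := by simpa [Real.dist_eq] using hx
      have h2 := abs_add_le (x - b) b
      rw [sub_add_cancel] at h2; linarith
    refine (abs_sub_one_mul_signedPow_le hp hs).trans ?_
    gcongr
  have hK : IntegrableOn
      (fun s : ℝ => (|A| + (|b| + 1)) ^ (p - 1) * (1 + s) ^ p * Real.exp (-s)) (Ioi 0) :=
    integrableOn_mul_exp_neg_of_le (K := (|A| + (|b| + 1)) ^ (p - 1)) (q := p) (by fun_prop)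
      (by linarith) fun s hs => by rw [abs_of_nonneg (by positivity)]
  refine (hasDerivAt_integral_of_dominated_loc_of_deriv_le
    (F := fun b s => |A + b * (s - 1)| ^ p * Real.exp (-s))
    (F' := fun b s => p * ((s - 1) * signedPow p (A + b * (s - 1)) * Real.exp (-s)))
    (bound := fun s => p * ((|A| + (|b| + 1)) ^ (p - 1) * (1 + s) ^ p * Real.exp (-s)))
    (Metric.ball_mem_nhds b one_pos) (Filter.Eventually.of_forall fun x => by fun_prop)
    (integrableOn_abs_add_rpow (by linarith) A b) (by fun_prop) ?_ (hK.const_mul p) ?_).2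
  · filter_upwards [ae_restrict_mem measurableSet_Ioi] with s hs x hx
    rw [Real.norm_eq_abs, abs_mul, abs_mul _ (Real.exp _), Real.abs_exp,
      abs_of_nonneg (by linarith : 0 ≤ p)]
    gcongr
    exact hbound x hx s hs
  · refine Filter.Eventually.of_forall fun s x _ => ?_
    have h1 : HasDerivAt (fun x : ℝ => A + x * (s - 1)) (1 * (s - 1)) x :=
      ((hasDerivAt_id x).mul_const (s - 1)).const_add A
    have h2 := (hasDerivAt_abs_rpow (A + x * (s - 1)) hp).comp x h1
    refine (h2.mul_const (Real.exp (-s))).congr_deriv ?_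
    rw [signedPow]; ring

/-- The derivative of `b ↦ ∫ (|A + b (s - 1)| ^ p - |b (s - 1)| ^ p) exp (-s) ds`, written so that
the dependence on `s` of the second factor is through `|b (s - 1) + A / 2|` only. -/
theorem hasDerivAt_integral_abs_add_rpow_sub {p : ℝ} (hp : 1 < p) (A b : ℝ) :
    IntegrableOn (fun s => (s - 1) * (signedPow p (|b * (s - 1) + A / 2| + A / 2)
        - signedPow p (|b * (s - 1) + A / 2| - A / 2)) * Real.exp (-s)) (Ioi 0) ∧
    HasDerivAt (fun b => (∫ s in Ioi (0 : ℝ), |A + b * (s - 1)| ^ p * Real.exp (-s))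
        - ∫ s in Ioi (0 : ℝ), |0 + b * (s - 1)| ^ p * Real.exp (-s))
      (p * ∫ s in Ioi (0 : ℝ), (s - 1) * (signedPow p (|b * (s - 1) + A / 2| + A / 2)
        - signedPow p (|b * (s - 1) + A / 2| - A / 2)) * Real.exp (-s)) b := by
  have e : (fun s => (s - 1) * (signedPow p (|b * (s - 1) + A / 2| + A / 2)
        - signedPow p (|b * (s - 1) + A / 2| - A / 2)) * Real.exp (-s)) =
      fun s => (s - 1) * signedPow p (A + b * (s - 1)) * Real.exp (-s)
        - (s - 1) * signedPow p (0 + b * (s - 1)) * Real.exp (-s) := by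
    funext s
    rw [← signedPow_add_sub_abs]
    rw [show b * (s - 1) + A / 2 + A / 2 = A + b * (s - 1) by ring,
      show b * (s - 1) + A / 2 - A / 2 = 0 + b * (s - 1) by ring]
    ring
  have h1 := integrableOn_sub_one_mul_signedPow hp A b
  have h2 := integrableOn_sub_one_mul_signedPow hp 0 b
  rw [e]
  refine ⟨h1.sub h2, ?_⟩
  refine ((hasDerivAt_integral_abs_add_rpow hp A b).sub
    (hasDerivAt_integral_abs_add_rpow hp 0 b)).congr_deriv ?_
  rw [integral_sub h1 h2, integral_const_mul, integral_const_mul]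
  ring

/-- The subtracted integral is `C_p b ^ p`. -/
theorem antitoneOn_integral_abs_add_rpow_sub {p A : ℝ} (hp : 1 ≤ p) (hp2 : p ≤ 2) (hA : 0 ≤ A) :
    AntitoneOn (fun b => (∫ s in Ioi (0 : ℝ), |A + b * (s - 1)| ^ p * Real.exp (-s))
        - ∫ s in Ioi (0 : ℝ), |0 + b * (s - 1)| ^ p * Real.exp (-s)) (Ici 0) := by
  rcases hp.eq_or_lt with rfl | hp
  · -- For `p = 1` this is the triangle inequality.
    intro b hb b' hb' hbb
    have hb : 0 ≤ b := hb
    have hb' : 0 ≤ b' := hb'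
    dsimp only
    have hi := fun A b => integrableOn_abs_add_rpow zero_le_one A b
    rw [← integral_sub (hi _ _) (hi _ _), ← integral_sub (hi _ _) (hi _ _)]
    refine integral_mono ((hi _ _).sub (hi _ _)) ((hi _ _).sub (hi _ _)) fun s => ?_
    simp only [Real.rpow_one, zero_add, abs_mul, abs_of_nonneg hb, abs_of_nonneg hb']
    rw [← sub_mul, ← sub_mul]
    gcongr ?_ * _
    have h := abs_add_le (A + b * (s - 1)) ((b' - b) * (s - 1))
    rw [abs_mul, abs_of_nonneg (by linarith : 0 ≤ b' - b)] at h
    rw [show A + b * (s - 1) + (b' - b) * (s - 1) = A + b' * (s - 1) by ring] at h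
    linarith
  · have hd := fun b => (hasDerivAt_integral_abs_add_rpow_sub hp A b).2
    refine antitoneOn_of_deriv_nonpos (convex_Ici 0)
      (fun b _ => (hd b).continuousAt.continuousWithinAt)
      (fun b _ => (hd b).differentiableAt.differentiableWithinAt) fun b hb => ?_
    rw [interior_Ici] at hb
    rw [(hd b).deriv]
    exact mul_nonpos_of_nonneg_of_nonpos (by linarith)
      (integral_sub_one_mul_comp_abs_nonpos
        (antitoneOn_signedPow_add_sub hp hp2 (by linarith : 0 ≤ A / 2)) hb (by linarith)
        (hasDerivAt_integral_abs_add_rpow_sub hp A b).1)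

theorem monotoneOn_integral_abs_add_rpow_sub {p A : ℝ} (hp2 : 2 ≤ p) (hA : 0 ≤ A) :
    MonotoneOn (fun b => (∫ s in Ioi (0 : ℝ), |A + b * (s - 1)| ^ p * Real.exp (-s))
        - ∫ s in Ioi (0 : ℝ), |0 + b * (s - 1)| ^ p * Real.exp (-s)) (Ici 0) := by
  have hp : 1 < p := by linarith
  have hd := fun b => (hasDerivAt_integral_abs_add_rpow_sub hp A b).2
  refine monotoneOn_of_deriv_nonneg (convex_Ici 0)
    (fun b _ => (hd b).continuousAt.continuousWithinAt)
    (fun b _ => (hd b).differentiableAt.differentiableWithinAt) fun b hb => ?_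
  rw [interior_Ici] at hb
  rw [(hd b).deriv]
  refine mul_nonneg (by linarith) (neg_nonpos.1 ?_)
  have e : ∀ s : ℝ, -((s - 1) * (signedPow p (|b * (s - 1) + A / 2| + A / 2)
      - signedPow p (|b * (s - 1) + A / 2| - A / 2)) * Real.exp (-s)) =
      (s - 1) * (-fun t => signedPow p (t + A / 2) - signedPow p (t - A / 2))
        |b * (s - 1) + A / 2| * Real.exp (-s) := by
    intro s
    rw [Pi.neg_apply]; ring
  rw [← integral_neg]
  simp only [e]
  refine integral_sub_one_mul_comp_abs_nonpos
    (monotoneOn_signedPow_add_sub hp2 (by linarith : 0 ≤ A / 2)).neg hb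
    (by linarith : 0 ≤ A / 2) ?_
  exact (hasDerivAt_integral_abs_add_rpow_sub hp A b).1.neg.congr_fun (fun s _ => e s)
    measurableSet_Ioi

/-! ### Step functions on a uniform grid -/

noncomputable section

/-- The step function with value `c k` on `[k h, (k + 1) h)`. -/
def gridStep (h : ℝ) (c : ℕ → ℝ) (x : ℝ) : ℝ := c ⌊x / h⌋₊

/-- The dual Hardy operator of a step function, as a real number. -/
def gridHardy (h : ℝ) (c : ℕ → ℝ) (x : ℝ) : ℝ := ∫ t in Ioi x, gridStep h c t / t

end

/-- `c` is a nonincreasing sequence of nonnegative numbers which vanishes from `M` on. -/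
structure IsStepSeq (c : ℕ → ℝ) (M : ℕ) : Prop where
  antitone : Antitone c
  nonneg : ∀ k, 0 ≤ c k
  eq_zero : ∀ k, M ≤ k → c k = 0

section

variable {h : ℝ} {c : ℕ → ℝ} {M : ℕ}

@[fun_prop]
theorem measurable_gridStep (h : ℝ) (c : ℕ → ℝ) : Measurable (gridStep h c) :=
  (measurable_from_top (f := c)).comp (Nat.measurable_floor.comp (measurable_id.div_const h))

theorem gridStep_of_mem (hh : 0 < h) {j : ℕ} {x : ℝ} (hx : x ∈ Ico (j * h) ((j + 1) * h)) :
    gridStep h c x = c j := by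
  have h0 : 0 ≤ x := le_trans (by positivity) hx.1
  rw [gridStep, (Nat.floor_eq_iff (by positivity)).2]
  exact ⟨(le_div_iff₀ hh).2 hx.1, (div_lt_iff₀ hh).2 hx.2⟩

theorem gridStep_eq_zero (hc : IsStepSeq c M) (hh : 0 < h) {x : ℝ} (hx : M * h ≤ x) :
    gridStep h c x = 0 :=
  hc.eq_zero _ (Nat.le_floor ((le_div_iff₀ hh).2 hx))

theorem gridStep_nonneg (hc : IsStepSeq c M) (x : ℝ) : 0 ≤ gridStep h c x := hc.nonneg _

theorem gridStep_le (hc : IsStepSeq c M) (x : ℝ) : gridStep h c x ≤ c 0 :=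
  hc.antitone (Nat.zero_le _)

theorem integrableOn_gridStep_div (hc : IsStepSeq c M) (hh : 0 < h) {x : ℝ} (hx : 0 < x) :
    IntegrableOn (fun t => gridStep h c t / t) (Ioi x) := by
  have h1 : IntegrableOn (fun t => gridStep h c t / t) (Ioc x (max x (M * h))) := by
    refine Measure.integrableOn_of_bounded (M := c 0 / x) measure_Ioc_lt_top.ne
      ((measurable_gridStep h c).div measurable_id).aestronglyMeasurable ?_
    filter_upwards [ae_restrict_mem measurableSet_Ioc] with t ht
    have ht0 : 0 < t := hx.trans ht.1
    rw [Real.norm_eq_abs, abs_of_nonneg (div_nonneg (gridStep_nonneg hc t) ht0.le)]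
    exact div_le_div₀ (hc.nonneg 0) (gridStep_le hc t) hx ht.1.le
  have h2 : IntegrableOn (fun t => gridStep h c t / t) (Ioi (max x (M * h))) := by
    refine (integrableOn_zero (s := Ioi (max x (M * h)))).congr_fun (fun t ht => ?_)
      measurableSet_Ioi
    rw [gridStep_eq_zero hc hh ((le_max_right _ _).trans (le_of_lt ht)), zero_div]
  rw [← Ioc_union_Ioi_eq_Ioi (le_max_left x (M * h))]
  exact h1.union h2

theorem gridHardy_nonneg (hc : IsStepSeq c M) {x : ℝ} (hx : 0 < x) : 0 ≤ gridHardy h c x :=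
  setIntegral_nonneg measurableSet_Ioi fun t ht =>
    div_nonneg (gridStep_nonneg hc t) (hx.trans ht).le

theorem dualHardy_gridStep (hc : IsStepSeq c M) (hh : 0 < h) {x : ℝ} (hx : 0 < x) :
    dualHardy (gridStep h c) x = ENNReal.ofReal (gridHardy h c x) := by
  rw [gridHardy, ofReal_integral_eq_lintegral_ofReal (integrableOn_gridStep_div hc hh hx),
    dualHardy]
  filter_upwards [ae_restrict_mem measurableSet_Ioi] with t ht
  exact div_nonneg (gridStep_nonneg hc t) (hx.trans ht).le

theorem gridHardy_eq_zero (hc : IsStepSeq c M) (hh : 0 < h) {x : ℝ} (hx : M * h ≤ x) :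
    gridHardy h c x = 0 := by
  rw [gridHardy]
  refine setIntegral_eq_zero_of_forall_eq_zero fun t ht => ?_
  rw [gridStep_eq_zero hc hh (hx.trans (le_of_lt ht)), zero_div]

theorem gridHardy_eq_add_log (hc : IsStepSeq c M) (hh : 0 < h) {j : ℕ} {x : ℝ} (hx0 : 0 < x)
    (hx : x ∈ Icc (j * h) ((j + 1) * h)) :
    gridHardy h c x = gridHardy h c ((j + 1) * h) + c j * Real.log ((j + 1) * h / x) := by
  have ha : 0 < (j + 1) * h := hx0.trans_le hx.2
  have hi := integrableOn_gridStep_div hc hh hx0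
  rw [gridHardy, ← Ioc_union_Ioi_eq_Ioi hx.2,
    setIntegral_union (Ioc_disjoint_Ioi le_rfl) measurableSet_Ioi
      (hi.mono_set Ioc_subset_Ioi_self) (hi.mono_set (Ioi_subset_Ioi hx.2)), add_comm]
  congr 1
  rw [integral_Ioc_eq_integral_Ioo, setIntegral_congr_fun (g := fun t => c j * t⁻¹)
    measurableSet_Ioo, integral_const_mul, ← integral_Ioc_eq_integral_Ioo,
    ← intervalIntegral.integral_of_le hx.2, integral_inv_of_pos hx0 ha]
  intro t ht
  dsimp only
  rw [gridStep_of_mem hh ⟨hx.1.trans ht.1.le, ht.2⟩, div_eq_mul_inv]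

theorem integrableOn_gridStep_rpow (hc : IsStepSeq c M) (hh : 0 < h) {p : ℝ} (hp : 0 < p) :
    IntegrableOn (fun x => gridStep h c x ^ p) (Ioi 0) := by
  have h0 : (0 : ℝ) ≤ M * h := by positivity
  rw [← Ioc_union_Ioi_eq_Ioi h0]
  refine IntegrableOn.union ?_ ?_
  · refine Measure.integrableOn_of_bounded (M := c 0 ^ p) measure_Ioc_lt_top.ne
      ((measurable_gridStep h c).pow_const p).aestronglyMeasurable ?_
    refine Filter.Eventually.of_forall fun t => ?_
    rw [Real.norm_eq_abs, abs_of_nonneg (Real.rpow_nonneg (gridStep_nonneg hc t) _)]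
    exact Real.rpow_le_rpow (gridStep_nonneg hc t) (gridStep_le hc t) hp.le
  · refine (integrableOn_zero (s := Ioi (M * h))).congr_fun (fun t ht => ?_) measurableSet_Ioi
    dsimp only
    rw [gridStep_eq_zero hc hh (le_of_lt ht), Real.zero_rpow hp.ne']

/-! ### Integrals of functions of `H* f` and `f` -/

theorem integrableOn_comp_gridHardy_cell {Θ : ℝ → ℝ → ℝ}
    (hint : ∀ A b, 0 ≤ A → 0 ≤ b →
      IntegrableOn (fun s => Θ (A + b * s) b * Real.exp (-s)) (Ioi 0))
    (hc : IsStepSeq c M) (hh : 0 < h) (j : ℕ) :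
    IntegrableOn (fun x => Θ (gridHardy h c x) (gridStep h c x)) (Ioo (j * h) ((j + 1) * h)) := by
  have ha : 0 < ((j : ℝ) + 1) * h := by positivity
  have hj : (0 : ℝ) ≤ j * h := by positivity
  have h1 := integrableOn_comp_log_div ha (hint _ _ (gridHardy_nonneg (h := h) hc ha) (hc.nonneg j))
  refine (h1.mono_set (Ioo_subset_Ioo_left hj)).congr_fun (fun x hx => ?_) measurableSet_Ioo
  dsimp only
  rw [gridHardy_eq_add_log hc hh (hj.trans_lt hx.1) ⟨hx.1.le, hx.2.le⟩,
    gridStep_of_mem hh ⟨hx.1.le, hx.2⟩]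

theorem integrableOn_comp_gridHardy_Ioi {Θ : ℝ → ℝ → ℝ} (h0 : Θ 0 0 = 0)
    (hint : ∀ A b, 0 ≤ A → 0 ≤ b →
      IntegrableOn (fun s => Θ (A + b * s) b * Real.exp (-s)) (Ioi 0))
    (hc : IsStepSeq c M) (hh : 0 < h) {j : ℕ} (hj : j ≤ M) :
    IntegrableOn (fun x => Θ (gridHardy h c x) (gridStep h c x)) (Ioi (j * h)) := by
  induction hj using Nat.decreasingInduction with
  | self =>
    refine (integrableOn_zero (s := Ioi (M * h))).congr_fun (fun x hx => ?_) measurableSet_Ioi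
    dsimp only
    rw [gridHardy_eq_zero hc hh (le_of_lt hx), gridStep_eq_zero hc hh (le_of_lt hx), h0]
  | of_succ j _ ih =>
    push_cast at ih
    rw [← Ioc_union_Ioi_eq_Ioi (by nlinarith : (j : ℝ) * h ≤ (j + 1) * h)]
    exact IntegrableOn.union
      ((integrableOn_Ioc_iff_integrableOn_Ioo (by simp)).2
        (integrableOn_comp_gridHardy_cell hint hc hh j)) ih

/-- A function `Θ` of `H* f` and `f` is integrated over `(0, ∞)`, for a step function `f`. Freezing
`f` on `(0, a)` at the value `b` makes `H* f = A + b log (a / x)` there, so that this part of the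
integral is `a ∫ Θ (A + b s, b) exp (-s) ds`. If the latter is nonincreasing in `b`, then
replacing the values of `f` cell by cell, from the right to the left, shows that the integral is
at most the one of `f = 0`. -/
theorem integral_comp_gridHardy_nonpos {Θ : ℝ → ℝ → ℝ} (h0 : Θ 0 0 = 0)
    (hint : ∀ A b, 0 ≤ A → 0 ≤ b →
      IntegrableOn (fun s => Θ (A + b * s) b * Real.exp (-s)) (Ioi 0))
    (hanti : ∀ A b' b, 0 ≤ A → 0 ≤ b' → b' ≤ b →
      ∫ s in Ioi (0 : ℝ), Θ (A + b * s) b * Real.exp (-s) ≤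
        ∫ s in Ioi (0 : ℝ), Θ (A + b' * s) b' * Real.exp (-s))
    (hc : IsStepSeq c M) (hh : 0 < h) :
    ∫ x in Ioi (0 : ℝ), Θ (gridHardy h c x) (gridStep h c x) ≤ 0 := by
  -- The right-hand side is the integral over `(0, j h)` for `f` frozen there at the value `c j`,
  -- up to the sign.
  have key : ∀ j : ℕ, j ≤ M → ∫ x in Ioi (j * h), Θ (gridHardy h c x) (gridStep h c x) ≤
      -(j * h * ∫ s in Ioi (0 : ℝ), Θ (gridHardy h c (j * h) + c j * s) (c j) * Real.exp (-s)) := by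
    intro j hj
    induction hj using Nat.decreasingInduction with
    | self =>
      rw [gridHardy_eq_zero hc hh le_rfl, hc.eq_zero M le_rfl,
        setIntegral_eq_zero_of_forall_eq_zero fun x hx => by
          rw [gridHardy_eq_zero hc hh (le_of_lt hx), gridStep_eq_zero hc hh (le_of_lt hx), h0]]
      simp [h0]
    | of_succ j hj ih =>
      push_cast at ih
      set a : ℝ := (j + 1) * h with ha_def
      have ha : 0 < a := by positivity
      have hja : (j : ℝ) * h ≤ a := by rw [ha_def]; nlinarith
      have hj0 : (0 : ℝ) ≤ j * h := by positivity
      have hA := gridHardy_nonneg (h := h) hc ha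
      set A : ℝ := gridHardy h c a
      have hcell : ∫ x in Ioc (j * h) a, Θ (gridHardy h c x) (gridStep h c x) =
          ∫ x in Ioc (j * h) a, Θ (A + c j * Real.log (a / x)) (c j) := by
        rw [integral_Ioc_eq_integral_Ioo, integral_Ioc_eq_integral_Ioo]
        refine setIntegral_congr_fun measurableSet_Ioo fun x hx => ?_
        rw [gridHardy_eq_add_log hc hh (hj0.trans_lt hx.1) ⟨hx.1.le, hx.2.le⟩,
          gridStep_of_mem hh ⟨hx.1.le, hx.2⟩]
      have hfull := integral_comp_log_div ha (fun s => Θ (A + c j * s) (c j))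
      have hfulli := (integrableOn_Ioc_iff_integrableOn_Ioo (by simp)).2
        (integrableOn_comp_log_div ha (hint A (c j) hA (hc.nonneg j)))
      rw [← integral_Ioc_eq_integral_Ioo, ← Ioc_union_Ioc_eq_Ioc hj0 hja,
        setIntegral_union (Ioc_disjoint_Ioc_of_le le_rfl) measurableSet_Ioc
          (hfulli.mono_set (Ioc_subset_Ioc_right hja))
          (hfulli.mono_set (Ioc_subset_Ioc_left hj0))] at hfull
      -- The part over `(0, j h)` has the same form with `a` replaced by `j h`; for `j = 0` it is
      -- empty.
      have hleft : ∫ x in Ioc 0 (j * h), Θ (A + c j * Real.log (a / x)) (c j) =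
          j * h * ∫ s in Ioi (0 : ℝ),
            Θ (gridHardy h c (j * h) + c j * s) (c j) * Real.exp (-s) := by
        rcases hj0.eq_or_lt with h1 | h1
        · rw [← h1]; simp
        · rw [← integral_comp_log_div h1
            (fun s => Θ (gridHardy h c (j * h) + c j * s) (c j)), integral_Ioc_eq_integral_Ioo]
          refine setIntegral_congr_fun measurableSet_Ioo fun x hx => ?_
          rw [gridHardy_eq_add_log hc hh h1 ⟨le_rfl, hja⟩, add_assoc, ← mul_add,
            ← Real.log_mul (by positivity) (div_pos h1 hx.1).ne', div_mul_div_cancel₀ h1.ne']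
      have hii := integrableOn_comp_gridHardy_Ioi h0 hint hc hh hj.le
      rw [← Ioc_union_Ioi_eq_Ioi hja, setIntegral_union (Ioc_disjoint_Ioi le_rfl) measurableSet_Ioi
        (hii.mono_set Ioc_subset_Ioi_self) (hii.mono_set (Ioi_subset_Ioi hja)), hcell]
      have hm := mul_le_mul_of_nonneg_left
        (hanti A (c (j + 1)) (c j) hA (hc.nonneg _) (hc.antitone (Nat.le_succ j))) ha.le
      rw [hleft] at hfull
      linarith
  simpa using key 0 (Nat.zero_le M)

end

/-! ### The inequalities for step functions -/

section

variable {h : ℝ} {c : ℕ → ℝ} {M : ℕ} {p : ℝ}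

theorem integrableOn_abs_add_mul_sub_rpow (hp : 0 ≤ p) (A b : ℝ) :
    IntegrableOn (fun s => |A + b * s - b| ^ p * Real.exp (-s)) (Ioi 0) := by
  have := integrableOn_abs_add_rpow hp A b
  simpa only [mul_sub, mul_one, add_sub_assoc] using this

theorem integrableOn_const_mul_exp_neg (K : ℝ) :
    IntegrableOn (fun s => K * Real.exp (-s)) (Ioi 0) :=
  (integrableOn_exp_neg_Ioi 0).const_mul K

theorem integrableOn_abs_gridHardy_sub_rpow (hp : 0 < p) (hc : IsStepSeq c M) (hh : 0 < h) :
    IntegrableOn (fun x => |gridHardy h c x - gridStep h c x| ^ p) (Ioi 0) := by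
  have := integrableOn_comp_gridHardy_Ioi (Θ := fun F f => |F - f| ^ p) (by simp [hp.ne'])
    (fun A b _ _ => integrableOn_abs_add_mul_sub_rpow hp.le A b) hc hh (Nat.zero_le M)
  simpa using this

/-- `C_p b ^ p` is the integral of `|b (s - 1)| ^ p` against the exponential density. -/
theorem integral_abs_sub_hardyC (hp : 0 ≤ p) {A b : ℝ} (hb : 0 ≤ b) :
    ∫ s in Ioi (0 : ℝ), (|A + b * s - b| ^ p - hardyC p * b ^ p) * Real.exp (-s) =
      (∫ s in Ioi (0 : ℝ), |A + b * (s - 1)| ^ p * Real.exp (-s))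
        - ∫ s in Ioi (0 : ℝ), |0 + b * (s - 1)| ^ p * Real.exp (-s) := by
  have e : ∫ s in Ioi (0 : ℝ), |0 + b * (s - 1)| ^ p * Real.exp (-s) = hardyC p * b ^ p := by
    rw [hardyC_eq_integral_exp, ← integral_mul_const]
    congr 1; funext s
    rw [zero_add, abs_mul, Real.mul_rpow (abs_nonneg _) (abs_nonneg _), abs_of_nonneg hb]; ring
  simp only [sub_mul]
  rw [integral_sub (integrableOn_abs_add_mul_sub_rpow hp A b) (integrableOn_const_mul_exp_neg _),
    integral_const_mul, integral_exp_neg_Ioi_eq_one, e, mul_one]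
  simp only [mul_sub, mul_one, add_sub_assoc]

theorem integrableOn_abs_sub_hardyC (hp : 0 ≤ p) (A b : ℝ) :
    IntegrableOn (fun s => (|A + b * s - b| ^ p - hardyC p * b ^ p) * Real.exp (-s)) (Ioi 0) := by
  simp only [sub_mul]
  exact (integrableOn_abs_add_mul_sub_rpow hp A b).sub (integrableOn_const_mul_exp_neg _)

theorem integral_abs_gridHardy_sub_rpow_le_hardyC (hp : 1 ≤ p) (hp2 : p ≤ 2)
    (hc : IsStepSeq c M) (hh : 0 < h) :
    ∫ x in Ioi (0 : ℝ), |gridHardy h c x - gridStep h c x| ^ p ≤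
      hardyC p * ∫ x in Ioi (0 : ℝ), gridStep h c x ^ p := by
  have hp0 : 0 < p := by linarith
  have key := integral_comp_gridHardy_nonpos (Θ := fun F f => |F - f| ^ p - hardyC p * f ^ p)
    (by simp [hp0.ne']) (fun A b _ _ => integrableOn_abs_sub_hardyC hp0.le A b)
    (fun A b' b hA hb' hb => by
      rw [integral_abs_sub_hardyC hp0.le hb', integral_abs_sub_hardyC hp0.le (hb'.trans hb)]
      exact antitoneOn_integral_abs_add_rpow_sub hp hp2 hA hb' (hb'.trans hb) hb) hc hh
  rw [integral_sub (integrableOn_abs_gridHardy_sub_rpow hp0 hc hh)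
    ((integrableOn_gridStep_rpow hc hh hp0).const_mul _), integral_const_mul] at key
  linarith

theorem hardyC_mul_le_integral_abs_gridHardy_sub_rpow (hp2 : 2 ≤ p)
    (hc : IsStepSeq c M) (hh : 0 < h) :
    hardyC p * ∫ x in Ioi (0 : ℝ), gridStep h c x ^ p ≤
      ∫ x in Ioi (0 : ℝ), |gridHardy h c x - gridStep h c x| ^ p := by
  have hp0 : 0 < p := by linarith
  have key := integral_comp_gridHardy_nonpos (Θ := fun F f => -(|F - f| ^ p - hardyC p * f ^ p))
    (by simp [hp0.ne'])
    (fun A b _ _ => by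
      simp only [neg_mul]
      exact (integrableOn_abs_sub_hardyC hp0.le A b).neg)
    (fun A b' b hA hb' hb => by
      simp only [neg_mul, integral_neg]
      rw [integral_abs_sub_hardyC hp0.le hb', integral_abs_sub_hardyC hp0.le (hb'.trans hb)]
      exact neg_le_neg
        (monotoneOn_integral_abs_add_rpow_sub hp2 hA hb' (hb'.trans hb) hb)) hc hh
  rw [integral_neg, integral_sub (integrableOn_abs_gridHardy_sub_rpow hp0 hc hh)
    ((integrableOn_gridStep_rpow hc hh hp0).const_mul _), integral_const_mul] at key
  linarith

theorem hasDerivAt_neg_rpow_mul_exp_neg (hp : 1 < p) (A b s : ℝ) :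
    HasDerivAt (fun s => -((A + b * s) ^ p * Real.exp (-s)))
      (((A + b * s) ^ p - p * (A + b * s) ^ (p - 1) * b) * Real.exp (-s)) s := by
  have h1 : HasDerivAt (fun s : ℝ => Real.exp (-s)) (Real.exp (-s) * -1) s :=
    (hasDerivAt_neg s).exp
  have h2 : HasDerivAt (fun s : ℝ => A + b * s) (b * 1) s :=
    ((hasDerivAt_id s).const_mul b).const_add A
  have h3 := h2.rpow_const (p := p) (Or.inr hp.le)
  exact (h3.mul h1).neg.congr_deriv (by ring)

theorem add_mul_rpow_le {q A b s : ℝ} (hq : 0 ≤ q) (hA : 0 ≤ A) (hb : 0 ≤ b) (hs : 0 ≤ s) :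
    (A + b * s) ^ q ≤ (A + b) ^ q * (1 + s) ^ q := by
  rw [← Real.mul_rpow (by positivity) (by positivity)]
  exact Real.rpow_le_rpow (by positivity) (by nlinarith [mul_nonneg hA hs]) hq

theorem integrableOn_add_mul_rpow {q A b : ℝ} (hq : 0 ≤ q) (hA : 0 ≤ A) (hb : 0 ≤ b) :
    IntegrableOn (fun s => (A + b * s) ^ q * Real.exp (-s)) (Ioi 0) := by
  refine integrableOn_mul_exp_neg_of_le (K := (A + b) ^ q) (q := q) (by fun_prop) hq ?_
  intro s hs
  rw [abs_of_nonneg (by positivity)]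
  exact add_mul_rpow_le hq hA hb hs.le

theorem integrableOn_rpow_sub_mul_rpow (hp : 1 < p) {A b : ℝ} (hA : 0 ≤ A) (hb : 0 ≤ b) :
    IntegrableOn (fun s => ((A + b * s) ^ p - p * (A + b * s) ^ (p - 1) * b) * Real.exp (-s))
      (Ioi 0) := by
  have h1 := integrableOn_add_mul_rpow (by linarith : 0 ≤ p) hA hb
  have h2 := (integrableOn_add_mul_rpow (by linarith : 0 ≤ p - 1) hA hb).const_mul (p * b)
  refine (h1.sub h2).congr_fun (fun s _ => ?_) measurableSet_Ioi
  simp only [Pi.sub_apply]; ring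

/-- The value does not depend on `b`, so that the monotonicity required by
`integral_comp_gridHardy_nonpos` holds in both directions. -/
theorem integral_rpow_sub_mul_rpow (hp : 1 < p) {A b : ℝ} (hA : 0 ≤ A) (hb : 0 ≤ b) :
    ∫ s in Ioi (0 : ℝ), ((A + b * s) ^ p - p * (A + b * s) ^ (p - 1) * b) * Real.exp (-s) =
      A ^ p := by
  obtain ⟨K, hK0, hK⟩ := exists_one_add_rpow_le_mul_exp (by linarith : 0 ≤ p)
  have hlim : Filter.Tendsto (fun s => -((A + b * s) ^ p * Real.exp (-s))) Filter.atTop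
      (nhds 0) := by
    rw [← neg_zero]
    refine Filter.Tendsto.neg ?_
    have hexp : Filter.Tendsto (fun s : ℝ => (A + b) ^ p * K * Real.exp (-(s / 2))) Filter.atTop
        (nhds 0) := by
      have := (Real.tendsto_exp_neg_atTop_nhds_zero.comp
        (Filter.tendsto_id.atTop_div_const (by norm_num : (0 : ℝ) < 2))).const_mul ((A + b) ^ p * K)
      simpa using this
    refine squeeze_zero' ?_ ?_ hexp <;> filter_upwards [Filter.eventually_ge_atTop 0] with s hs
    · positivity
    · calc (A + b * s) ^ p * Real.exp (-s)
          ≤ ((A + b) ^ p * (K * Real.exp (s / 2))) * Real.exp (-s) := by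
            gcongr
            refine (add_mul_rpow_le (by linarith) hA hb hs).trans ?_
            gcongr
            exact hK s hs
        _ = (A + b) ^ p * K * Real.exp (-(s / 2)) := by
            rw [show -(s / 2) = s / 2 + -s by ring, Real.exp_add]; ring
  have := integral_Ioi_of_hasDerivAt_of_tendsto'
    (fun s _ => hasDerivAt_neg_rpow_mul_exp_neg hp A b s)
    (integrableOn_rpow_sub_mul_rpow hp hA hb) hlim
  simpa using this

theorem integrableOn_gridHardy_rpow_sub (hp : 1 < p) (hc : IsStepSeq c M) (hh : 0 < h) :
    IntegrableOn (fun x => gridHardy h c x ^ p - p * gridHardy h c x ^ (p - 1) * gridStep h c x)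
      (Ioi 0) := by
  have := integrableOn_comp_gridHardy_Ioi (Θ := fun F f => F ^ p - p * F ^ (p - 1) * f)
    (by simp [(by linarith : p ≠ 0)])
    (fun A b hA hb => integrableOn_rpow_sub_mul_rpow hp hA hb) hc hh (Nat.zero_le M)
  simpa using this

/-- Off the grid, the integrand is the derivative of `x (H* f x) ^ p`. -/
theorem integral_gridHardy_rpow_sub (hp : 1 < p) (hc : IsStepSeq c M) (hh : 0 < h) :
    ∫ x in Ioi (0 : ℝ),
      (gridHardy h c x ^ p - p * gridHardy h c x ^ (p - 1) * gridStep h c x) = 0 := by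
  have hp0 : p ≠ 0 := by linarith
  refine le_antisymm ?_ (neg_nonpos.1 ?_)
  · refine integral_comp_gridHardy_nonpos (Θ := fun F f => F ^ p - p * F ^ (p - 1) * f)
      (by simp [hp0]) (fun A b hA hb => integrableOn_rpow_sub_mul_rpow hp hA hb)
      (fun A b' b hA hb' hb => ?_) hc hh
    rw [integral_rpow_sub_mul_rpow hp hA hb', integral_rpow_sub_mul_rpow hp hA (hb'.trans hb)]
  · rw [← integral_neg]
    refine integral_comp_gridHardy_nonpos (Θ := fun F f => -(F ^ p - p * F ^ (p - 1) * f))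
      (by simp [hp0]) (fun A b hA hb => ?_) (fun A b' b hA hb' hb => ?_) hc hh
    · simp only [neg_mul]
      exact (integrableOn_rpow_sub_mul_rpow hp hA hb).neg
    · simp only [neg_mul, integral_neg]
      rw [integral_rpow_sub_mul_rpow hp hA hb', integral_rpow_sub_mul_rpow hp hA (hb'.trans hb)]

theorem integral_mul_gridStep_rpow (hp : 1 < p) (hc : IsStepSeq c M) :
    ∫ x in Ioi (0 : ℝ), ((p - 1) * gridStep h c x) ^ p =
      (p - 1) ^ p * ∫ x in Ioi (0 : ℝ), gridStep h c x ^ p := by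
  rw [← integral_const_mul]
  congr 1; funext x
  rw [Real.mul_rpow (by linarith) (gridStep_nonneg hc x)]

theorem integrableOn_mul_gridStep_rpow (hp : 1 < p) (hc : IsStepSeq c M) (hh : 0 < h) :
    IntegrableOn (fun x => ((p - 1) * gridStep h c x) ^ p) (Ioi 0) := by
  refine IntegrableOn.congr_fun
    ((integrableOn_gridStep_rpow hc hh (by linarith : 0 < p)).const_mul ((p - 1) ^ p))
    (fun x _ => ?_) measurableSet_Ioi
  rw [Real.mul_rpow (by linarith) (gridStep_nonneg hc x)]

/-- The pointwise tangent-line inequality is integrated; its right-hand side has integral `0`. -/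
theorem integral_abs_gridHardy_sub_rpow_le (hp2 : 2 ≤ p) (hc : IsStepSeq c M) (hh : 0 < h) :
    ∫ x in Ioi (0 : ℝ), |gridHardy h c x - gridStep h c x| ^ p ≤
      (p - 1) ^ p * ∫ x in Ioi (0 : ℝ), gridStep h c x ^ p := by
  have hp : 1 < p := by linarith
  have h1 := integrableOn_abs_gridHardy_sub_rpow (by linarith : 0 < p) hc hh
  have h2 := integrableOn_mul_gridStep_rpow hp hc hh
  have key := setIntegral_mono_on (h1.sub h2)
    ((integrableOn_gridHardy_rpow_sub hp hc hh).const_mul (tangentSlope p)) measurableSet_Ioi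
    fun x hx => abs_sub_rpow_sub_le_of_two_le hp2 (gridHardy_nonneg hc hx) (gridStep_nonneg hc x)
  rw [integral_const_mul, integral_gridHardy_rpow_sub hp hc hh, mul_zero] at key
  simp only [Pi.sub_apply] at key
  rw [integral_sub h1 h2, integral_mul_gridStep_rpow hp hc] at key
  linarith

theorem le_integral_abs_gridHardy_sub_rpow (hp : 1 < p) (hp2 : p ≤ 2) (hc : IsStepSeq c M)
    (hh : 0 < h) :
    (p - 1) ^ p * ∫ x in Ioi (0 : ℝ), gridStep h c x ^ p ≤
      ∫ x in Ioi (0 : ℝ), |gridHardy h c x - gridStep h c x| ^ p := by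
  have h1 := integrableOn_abs_gridHardy_sub_rpow (by linarith : 0 < p) hc hh
  have h2 := integrableOn_mul_gridStep_rpow hp hc hh
  have key := setIntegral_mono_on
    ((integrableOn_gridHardy_rpow_sub hp hc hh).const_mul (tangentSlope p)) (h1.sub h2)
    measurableSet_Ioi
    fun x hx => le_abs_sub_rpow_sub_of_le_two hp hp2 (gridHardy_nonneg hc hx) (gridStep_nonneg hc x)
  rw [integral_const_mul, integral_gridHardy_rpow_sub hp hc hh, mul_zero] at key
  simp only [Pi.sub_apply] at key
  rw [integral_sub h1 h2, integral_mul_gridStep_rpow hp hc] at key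
  linarith

end

/-! ### Approximation by step functions -/

noncomputable section

/-- Samples of `f` at the right endpoints of the cells of length `1 / (n + 1)`, cut off at the
abscissa `n + 1`. -/
def sampleSeq (f : ℝ → ℝ) (n k : ℕ) : ℝ :=
  if k < (n + 1) * (n + 1) then f ((k + 1) / (n + 1)) else 0

/-- The step function with the values `sampleSeq f n`; it lies below `f`. -/
def sampleStep (f : ℝ → ℝ) (n : ℕ) : ℝ → ℝ := gridStep (1 / (n + 1)) (sampleSeq f n)

/-- The dual Hardy operator of `sampleStep f n`. -/
def sampleHardy (f : ℝ → ℝ) (n : ℕ) : ℝ → ℝ := gridHardy (1 / (n + 1)) (sampleSeq f n)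

end

section

variable {f : ℝ → ℝ} {p : ℝ}

theorem isStepSeq_sampleSeq (hf : NonnegNonincr f) (n : ℕ) :
    IsStepSeq (sampleSeq f n) ((n + 1) * (n + 1)) where
  antitone := by
    intro i j hij
    simp only [sampleSeq]
    split_ifs with h1 h2 h2
    · exact hf.2 (mem_Ioi.2 (by positivity)) (mem_Ioi.2 (by positivity)) (by gcongr)
    · omega
    · exact hf.1 _ (by positivity)
    · exact le_rfl
  nonneg := by
    intro k
    simp only [sampleSeq]
    split_ifs
    · exact hf.1 _ (by positivity)
    · exact le_rfl
  eq_zero := fun k hk => if_neg (by omega)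

theorem sampleStep_nonneg (hf : NonnegNonincr f) (n : ℕ) (x : ℝ) : 0 ≤ sampleStep f n x :=
  gridStep_nonneg (isStepSeq_sampleSeq hf n) x

theorem measurable_sampleStep (f : ℝ → ℝ) (n : ℕ) : Measurable (sampleStep f n) :=
  measurable_gridStep _ _

theorem sampleStep_le (hf : NonnegNonincr f) (n : ℕ) {x : ℝ} (hx : 0 < x) :
    sampleStep f n x ≤ f x := by
  simp only [sampleStep, gridStep, sampleSeq]
  split_ifs
  · refine hf.2 hx (mem_Ioi.2 (by positivity)) ?_
    rw [le_div_iff₀ (by positivity)]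
    have := (Nat.lt_floor_add_one (x / (1 / ((n : ℝ) + 1)))).le
    rwa [div_div_eq_mul_div, div_one] at this ⊢
  · exact hf.1 x hx

theorem tendsto_sampleStep {x : ℝ} (hx : 0 < x) (hfx : ContinuousWithinAt f (Ioi 0) x) :
    Filter.Tendsto (fun n => sampleStep f n x) Filter.atTop (nhds (f x)) := by
  have hcast : Filter.Tendsto (fun n : ℕ => (n : ℝ) + 1) Filter.atTop Filter.atTop :=
    Filter.tendsto_atTop_add_const_right _ _ tendsto_natCast_atTop_atTop
  have h1 : Filter.Tendsto (fun n : ℕ => ((⌊x * ((n : ℝ) + 1)⌋₊ : ℝ) + 1) / ((n : ℝ) + 1))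
      Filter.atTop (nhdsWithin x (Ioi 0)) := by
    refine tendsto_nhdsWithin_iff.2
      ⟨?_, Filter.Eventually.of_forall fun n => mem_Ioi.2 (by positivity)⟩
    have h2 := ((tendsto_nat_floor_mul_div_atTop hx.le).comp hcast).add
      (tendsto_inv_atTop_zero.comp hcast)
    simpa [Function.comp_def, add_div] using h2
  refine (hfx.tendsto.comp h1).congr' ?_
  filter_upwards [Filter.eventually_ge_atTop ⌈x⌉₊] with n hn
  have hxn : x < (n : ℝ) + 1 := by
    have := Nat.ceil_le.1 hn
    linarith
  have hlt : ⌊x * ((n : ℝ) + 1)⌋₊ < (n + 1) * (n + 1) := by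
    rw [Nat.floor_lt (by positivity)]
    push_cast
    gcongr
  simp only [sampleStep, gridStep, sampleSeq, Function.comp_def, div_div_eq_mul_div, div_one,
    if_pos hlt]

theorem ae_tendsto_sampleStep (hf : NonnegNonincr f) :
    ∀ᵐ x ∂volume.restrict (Ioi (0 : ℝ)),
      Filter.Tendsto (fun n => sampleStep f n x) Filter.atTop (nhds (f x)) := by
  have h := hf.2.countable_not_continuousWithinAt.ae_notMem (volume.restrict (Ioi (0 : ℝ)))
  filter_upwards [h, ae_restrict_mem measurableSet_Ioi] with x hx hx0
  exact tendsto_sampleStep hx0 (by by_contra hc; exact hx ⟨hx0, hc⟩)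

theorem aemeasurable_of_nonnegNonincr (hf : NonnegNonincr f) :
    AEMeasurable f (volume.restrict (Ioi 0)) :=
  aemeasurable_restrict_of_antitoneOn measurableSet_Ioi hf.2

/-- A nonincreasing function in `L^p` is `O(t ^ (-1 / p))`. -/
theorem exists_le_mul_rpow (hp : 0 < p) (hf : NonnegNonincr f)
    (hfin : ∫⁻ x in Ioi (0 : ℝ), ENNReal.ofReal (f x ^ p) ≠ ∞) :
    ∃ K : ℝ, 0 ≤ K ∧ ∀ t, 0 < t → f t ≤ K * t ^ (-(1 / p)) := by
  set I := (∫⁻ x in Ioi (0 : ℝ), ENNReal.ofReal (f x ^ p)).toReal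
  refine ⟨I ^ (1 / p), by positivity, fun t ht => ?_⟩
  have h0 := hf.1 t ht
  have h1 : ENNReal.ofReal (f t ^ p * t) ≤ ∫⁻ x in Ioi (0 : ℝ), ENNReal.ofReal (f x ^ p) := by
    calc ENNReal.ofReal (f t ^ p * t) = ∫⁻ _ in Ioc 0 t, ENNReal.ofReal (f t ^ p) := by
          rw [setLIntegral_const, Real.volume_Ioc, sub_zero, ENNReal.ofReal_mul (by positivity)]
      _ ≤ ∫⁻ x in Ioc 0 t, ENNReal.ofReal (f x ^ p) :=
          setLIntegral_mono' measurableSet_Ioc fun x hx =>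
            ENNReal.ofReal_le_ofReal (Real.rpow_le_rpow h0 (hf.2 hx.1 ht hx.2) hp.le)
      _ ≤ _ := lintegral_mono_set Ioc_subset_Ioi_self
  have h2 : f t ^ p * t ≤ I := (ENNReal.ofReal_le_iff_le_toReal hfin).1 h1
  have h3 : f t * t ^ (1 / p) ≤ I ^ (1 / p) := by
    have := Real.rpow_le_rpow (by positivity) h2 (by positivity : 0 ≤ 1 / p)
    rwa [Real.mul_rpow (by positivity) ht.le, ← Real.rpow_mul h0, mul_one_div_cancel hp.ne',
      Real.rpow_one] at this
  rw [Real.rpow_neg ht.le, ← div_eq_mul_inv, le_div_iff₀ (by positivity)]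
  exact h3

theorem dualHardy_ne_top (hp : 0 < p) (hf : NonnegNonincr f)
    (hfin : ∫⁻ x in Ioi (0 : ℝ), ENNReal.ofReal (f x ^ p) ≠ ∞) {x : ℝ} (hx : 0 < x) :
    dualHardy f x ≠ ∞ := by
  obtain ⟨K, _, hK⟩ := exists_le_mul_rpow hp hf hfin
  have hi : IntegrableOn (fun t : ℝ => K * t ^ (-(1 / p) - 1)) (Ioi x) :=
    (integrableOn_Ioi_rpow_of_lt (by have : 0 < 1 / p := by positivity
                                     linarith) hx).const_mul K
  refine ((setLIntegral_mono' measurableSet_Ioi fun t ht => ?_).trans_lt hi.lintegral_lt_top).ne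
  have ht0 : 0 < t := hx.trans ht
  refine ENNReal.ofReal_le_ofReal ?_
  rw [Real.rpow_sub_one ht0.ne', ← mul_div_assoc]
  gcongr
  exact hK t ht0

theorem dualHardy_sampleStep (hf : NonnegNonincr f) (n : ℕ) {x : ℝ} (hx : 0 < x) :
    dualHardy (sampleStep f n) x = ENNReal.ofReal (sampleHardy f n x) :=
  dualHardy_gridStep (isStepSeq_sampleSeq hf n) (by positivity) hx

theorem sampleHardy_nonneg (hf : NonnegNonincr f) (n : ℕ) {x : ℝ} (hx : 0 < x) :
    0 ≤ sampleHardy f n x :=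
  gridHardy_nonneg (isStepSeq_sampleSeq hf n) hx

theorem sampleHardy_le (hf : NonnegNonincr f) (n : ℕ) {x : ℝ} (hx : 0 < x)
    (hfin : dualHardy f x ≠ ∞) : sampleHardy f n x ≤ (dualHardy f x).toReal := by
  rw [← ENNReal.ofReal_le_iff_le_toReal hfin, ← dualHardy_sampleStep hf n hx]
  refine setLIntegral_mono' measurableSet_Ioi fun t ht => ENNReal.ofReal_le_ofReal ?_
  have ht0 : 0 < t := hx.trans ht
  gcongr
  exact sampleStep_le hf n ht0

theorem tendsto_sampleHardy (hf : NonnegNonincr f) {x : ℝ} (hx : 0 < x)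
    (hfin : dualHardy f x ≠ ∞) :
    Filter.Tendsto (fun n => sampleHardy f n x) Filter.atTop
      (nhds (dualHardy f x).toReal) := by
  have h : Filter.Tendsto (fun n => dualHardy (sampleStep f n) x) Filter.atTop
      (nhds (dualHardy f x)) := by
    refine tendsto_lintegral_of_dominated_convergence' (fun t => ENNReal.ofReal (f t / t))
      (fun n => ((measurable_sampleStep f n).div measurable_id).ennreal_ofReal.aemeasurable)
      (fun n => ?_) hfin ?_
    · filter_upwards [ae_restrict_mem measurableSet_Ioi] with t ht
      have ht0 : 0 < t := hx.trans ht
      refine ENNReal.ofReal_le_ofReal ?_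
      gcongr
      exact sampleStep_le hf n ht0
    · have := ae_mono (Measure.restrict_mono (Ioi_subset_Ioi hx.le) le_rfl)
        (ae_tendsto_sampleStep hf)
      filter_upwards [this] with t ht
      exact ENNReal.tendsto_ofReal (ht.div_const t)
  refine ((ENNReal.tendsto_toReal hfin).comp h).congr fun n => ?_
  rw [Function.comp_apply, dualHardy_sampleStep hf n hx,
    ENNReal.toReal_ofReal (sampleHardy_nonneg hf n hx)]

theorem ae_tendsto_abs_sub_rpow (hp : 0 < p) (hf : NonnegNonincr f)
    (hfin : ∫⁻ x in Ioi (0 : ℝ), ENNReal.ofReal (f x ^ p) ≠ ∞) :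
    ∀ᵐ x ∂volume.restrict (Ioi (0 : ℝ)), Filter.Tendsto
      (fun n => ENNReal.ofReal (|sampleHardy f n x - sampleStep f n x| ^ p)) Filter.atTop
      (nhds (ENNReal.ofReal (|(dualHardy f x).toReal - f x| ^ p))) := by
  filter_upwards [ae_tendsto_sampleStep hf, ae_restrict_mem measurableSet_Ioi] with x hx hx0
  exact ENNReal.tendsto_ofReal
    (((tendsto_sampleHardy hf hx0 (dualHardy_ne_top hp hf hfin hx0)).sub hx).abs.rpow_const
      (Or.inr hp.le))

theorem tendsto_lintegral_sampleStep_rpow (hp : 0 < p) (hf : NonnegNonincr f)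
    (hfin : ∫⁻ x in Ioi (0 : ℝ), ENNReal.ofReal (f x ^ p) ≠ ∞) :
    Filter.Tendsto (fun n => ∫⁻ x in Ioi (0 : ℝ), ENNReal.ofReal (sampleStep f n x ^ p))
      Filter.atTop (nhds (∫⁻ x in Ioi (0 : ℝ), ENNReal.ofReal (f x ^ p))) := by
  refine tendsto_lintegral_of_dominated_convergence' _
    (fun n => ((measurable_sampleStep f n).pow_const p).ennreal_ofReal.aemeasurable)
    (fun n => ?_) hfin ?_
  · filter_upwards [ae_restrict_mem measurableSet_Ioi] with x hx
    exact ENNReal.ofReal_le_ofReal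
      (Real.rpow_le_rpow (sampleStep_nonneg hf n x) (sampleStep_le hf n hx) hp.le)
  · filter_upwards [ae_tendsto_sampleStep hf] with x hx
    exact ENNReal.tendsto_ofReal (hx.rpow_const (Or.inr hp.le))

theorem lintegral_sampleStep_rpow (hp : 0 < p) (hf : NonnegNonincr f) (n : ℕ) :
    ∫⁻ x in Ioi (0 : ℝ), ENNReal.ofReal (sampleStep f n x ^ p) =
      ENNReal.ofReal (∫ x in Ioi (0 : ℝ), sampleStep f n x ^ p) :=
  (ofReal_integral_eq_lintegral_ofReal
    (integrableOn_gridStep_rpow (isStepSeq_sampleSeq hf n) (by positivity) hp)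
    (Filter.Eventually.of_forall fun x => Real.rpow_nonneg (sampleStep_nonneg hf n x) p)).symm

theorem integrableOn_abs_sampleHardy_sub_rpow (hp : 0 < p) (hf : NonnegNonincr f) (n : ℕ) :
    IntegrableOn (fun x => |sampleHardy f n x - sampleStep f n x| ^ p) (Ioi 0) :=
  integrableOn_abs_gridHardy_sub_rpow hp (isStepSeq_sampleSeq hf n) (by positivity)

theorem lintegral_abs_sampleHardy_sub_rpow (hp : 0 < p) (hf : NonnegNonincr f) (n : ℕ) :
    ∫⁻ x in Ioi (0 : ℝ), ENNReal.ofReal (|sampleHardy f n x - sampleStep f n x| ^ p) =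
      ENNReal.ofReal (∫ x in Ioi (0 : ℝ), |sampleHardy f n x - sampleStep f n x| ^ p) :=
  (ofReal_integral_eq_lintegral_ofReal (integrableOn_abs_sampleHardy_sub_rpow hp hf n)
    (Filter.Eventually.of_forall fun _ => Real.rpow_nonneg (abs_nonneg _) p)).symm

/-- An upper bound for step functions extends to `L^p` by Fatou's lemma. -/
theorem lintegral_abs_sub_rpow_le {K : ℝ} (hK : 0 ≤ K) (hp : 0 < p)
    (hstep : ∀ (h : ℝ) (c : ℕ → ℝ) (M : ℕ), IsStepSeq c M → 0 < h →
      ∫ x in Ioi (0 : ℝ), |gridHardy h c x - gridStep h c x| ^ p ≤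
        K * ∫ x in Ioi (0 : ℝ), gridStep h c x ^ p)
    (hf : NonnegNonincr f) (hfin : ∫⁻ x in Ioi (0 : ℝ), ENNReal.ofReal (f x ^ p) ≠ ∞) :
    ∫⁻ x in Ioi (0 : ℝ), ENNReal.ofReal (|(dualHardy f x).toReal - f x| ^ p) ≤
      ENNReal.ofReal K * ∫⁻ x in Ioi (0 : ℝ), ENNReal.ofReal (f x ^ p) := by
  calc ∫⁻ x in Ioi (0 : ℝ), ENNReal.ofReal (|(dualHardy f x).toReal - f x| ^ p)
      = ∫⁻ x in Ioi (0 : ℝ), Filter.liminf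
          (fun n => ENNReal.ofReal (|sampleHardy f n x - sampleStep f n x| ^ p))
            Filter.atTop := by
        refine lintegral_congr_ae ?_
        filter_upwards [ae_tendsto_abs_sub_rpow hp hf hfin] with x hx
        exact hx.liminf_eq.symm
    _ ≤ Filter.liminf (fun n => ∫⁻ x in Ioi (0 : ℝ),
          ENNReal.ofReal (|sampleHardy f n x - sampleStep f n x| ^ p)) Filter.atTop :=
        lintegral_liminf_le' fun n =>
          (integrableOn_abs_sampleHardy_sub_rpow hp hf n).aemeasurable.ennreal_ofReal
    _ ≤ Filter.liminf (fun n => ENNReal.ofReal K *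
          ∫⁻ x in Ioi (0 : ℝ), ENNReal.ofReal (sampleStep f n x ^ p)) Filter.atTop := by
        refine Filter.liminf_le_liminf (Filter.Eventually.of_forall fun n => ?_)
        rw [lintegral_abs_sampleHardy_sub_rpow hp hf, lintegral_sampleStep_rpow hp hf,
          ← ENNReal.ofReal_mul hK]
        exact ENNReal.ofReal_le_ofReal
          (hstep _ _ _ (isStepSeq_sampleSeq hf n) (by positivity))
    _ = _ := (ENNReal.Tendsto.const_mul (tendsto_lintegral_sampleStep_rpow hp hf hfin)
        (Or.inr ENNReal.ofReal_ne_top)).liminf_eq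

theorem lintegral_add_rpow_ne_top (hp : 1 ≤ p) (hf : NonnegNonincr f)
    (hfin : ∫⁻ x in Ioi (0 : ℝ), ENNReal.ofReal (f x ^ p) ≠ ∞)
    (hfin' : ∫⁻ x in Ioi (0 : ℝ), ENNReal.ofReal (|(dualHardy f x).toReal - f x| ^ p) ≠ ∞) :
    ∫⁻ x in Ioi (0 : ℝ), ENNReal.ofReal (((dualHardy f x).toReal + f x) ^ p) ≠ ∞ := by
  have hp0 : 0 ≤ p := by linarith
  have hle : ∫⁻ x in Ioi (0 : ℝ), ENNReal.ofReal (((dualHardy f x).toReal + f x) ^ p) ≤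
      ∫⁻ x in Ioi (0 : ℝ), 2 ^ (p - 1) * (ENNReal.ofReal (|(dualHardy f x).toReal - f x| ^ p) +
        ENNReal.ofReal (2 ^ p) * ENNReal.ofReal (f x ^ p)) := by
    refine setLIntegral_mono' measurableSet_Ioi fun x hx => ?_
    have h0 := hf.1 x hx
    have h1 : (dualHardy f x).toReal + f x ≤ |(dualHardy f x).toReal - f x| + 2 * f x := by
      linarith [le_abs_self ((dualHardy f x).toReal - f x)]
    rw [← ENNReal.ofReal_mul (by positivity), ← Real.mul_rpow zero_le_two h0,
      ← ENNReal.ofReal_rpow_of_nonneg (by positivity) hp0,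
      ← ENNReal.ofReal_rpow_of_nonneg (by positivity) hp0,
      ← ENNReal.ofReal_rpow_of_nonneg (by positivity) hp0]
    refine le_trans ?_ (ENNReal.rpow_add_le_mul_rpow_add_rpow _ _ hp)
    rw [← ENNReal.ofReal_add (by positivity) (by positivity)]
    exact ENNReal.rpow_le_rpow (ENNReal.ofReal_le_ofReal h1) hp0
  refine ne_top_of_le_ne_top ?_ hle
  have h2 : (2 : ℝ≥0∞) ^ (p - 1) ≠ ∞ := ENNReal.rpow_ne_top_of_nonneg (by linarith) (by simp)
  rw [lintegral_const_mul' _ _ h2, lintegral_add_right'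
    _ (((aemeasurable_of_nonnegNonincr hf).pow_const p).ennreal_ofReal.const_mul _),
    lintegral_const_mul' _ _ ENNReal.ofReal_ne_top]
  exact ENNReal.mul_ne_top h2
    (ENNReal.add_ne_top.2 ⟨hfin', ENNReal.mul_ne_top ENNReal.ofReal_ne_top hfin⟩)

/-- A lower bound for step functions extends to `L^p` by dominated convergence: unless
`H* f - f` has infinite norm, `H* f + f` is in `L^p` and dominates. -/
theorem le_lintegral_abs_sub_rpow {K : ℝ} (hK : 0 ≤ K) (hp : 1 ≤ p)
    (hstep : ∀ (h : ℝ) (c : ℕ → ℝ) (M : ℕ), IsStepSeq c M → 0 < h →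
      K * ∫ x in Ioi (0 : ℝ), gridStep h c x ^ p ≤
        ∫ x in Ioi (0 : ℝ), |gridHardy h c x - gridStep h c x| ^ p)
    (hf : NonnegNonincr f) (hfin : ∫⁻ x in Ioi (0 : ℝ), ENNReal.ofReal (f x ^ p) ≠ ∞) :
    ENNReal.ofReal K * ∫⁻ x in Ioi (0 : ℝ), ENNReal.ofReal (f x ^ p) ≤
      ∫⁻ x in Ioi (0 : ℝ), ENNReal.ofReal (|(dualHardy f x).toReal - f x| ^ p) := by
  have hp0 : 0 < p := by linarith
  by_cases hfin' : ∫⁻ x in Ioi (0 : ℝ), ENNReal.ofReal (|(dualHardy f x).toReal - f x| ^ p) = ∞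
  · rw [hfin']; exact le_top
  have hlim := tendsto_lintegral_of_dominated_convergence'
    (fun x => ENNReal.ofReal (((dualHardy f x).toReal + f x) ^ p))
    (fun n => (integrableOn_abs_sampleHardy_sub_rpow hp0 hf n).aemeasurable.ennreal_ofReal)
    (fun n => by
      filter_upwards [ae_restrict_mem measurableSet_Ioi] with x hx
      have h1 := sampleHardy_le hf n hx (dualHardy_ne_top hp0 hf hfin hx)
      have h2 := sampleStep_le hf n hx
      have h3 := sampleHardy_nonneg hf n hx
      have h4 := sampleStep_nonneg hf n x
      refine ENNReal.ofReal_le_ofReal (Real.rpow_le_rpow (abs_nonneg _) ?_ hp0.le)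
      rw [abs_le]; constructor <;> linarith)
    (lintegral_add_rpow_ne_top hp hf hfin hfin') (ae_tendsto_abs_sub_rpow hp0 hf hfin)
  refine le_of_tendsto_of_tendsto' (ENNReal.Tendsto.const_mul
    (tendsto_lintegral_sampleStep_rpow hp0 hf hfin) (Or.inr ENNReal.ofReal_ne_top)) hlim
    fun n => ?_
  rw [lintegral_abs_sampleHardy_sub_rpow hp0 hf, lintegral_sampleStep_rpow hp0 hf,
    ← ENNReal.ofReal_mul hK]
  exact ENNReal.ofReal_le_ofReal (hstep _ _ _ (isStepSeq_sampleSeq hf n) (by positivity))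

/-! ### Norms -/

theorem lintegral_abs_coe_rpow (hp : 0 ≤ p) (hf : NonnegNonincr f) :
    ∫⁻ x in Ioi (0 : ℝ), (f x : EReal).abs ^ p = ∫⁻ x in Ioi (0 : ℝ), ENNReal.ofReal (f x ^ p) := by
  refine setLIntegral_congr_fun measurableSet_Ioi fun x hx => ?_
  have h0 := hf.1 x hx
  rw [EReal.abs_def, abs_of_nonneg h0, ENNReal.ofReal_rpow_of_nonneg h0 hp]

theorem abs_dualHardySubId_rpow (hp : 0 ≤ p) {x : ℝ} (hfin : dualHardy f x ≠ ∞) :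
    (dualHardySubId f x).abs ^ p = ENNReal.ofReal (|(dualHardy f x).toReal - f x| ^ p) := by
  rw [dualHardySubId, ← EReal.coe_ennreal_toReal hfin, ← EReal.coe_sub, EReal.abs_def,
    ENNReal.ofReal_rpow_of_nonneg (abs_nonneg _) hp]

theorem lintegral_abs_dualHardySubId_rpow (hp : 0 < p) (hf : NonnegNonincr f)
    (hfin : ∫⁻ x in Ioi (0 : ℝ), ENNReal.ofReal (f x ^ p) ≠ ∞) :
    ∫⁻ x in Ioi (0 : ℝ), (dualHardySubId f x).abs ^ p =
      ∫⁻ x in Ioi (0 : ℝ), ENNReal.ofReal (|(dualHardy f x).toReal - f x| ^ p) :=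
  setLIntegral_congr_fun measurableSet_Ioi fun _ hx =>
    abs_dualHardySubId_rpow hp.le (dualHardy_ne_top hp hf hfin hx)

theorem lintegral_ne_top_of_lpNormPos_lt_top (hp : 0 < p) (hf : NonnegNonincr f)
    (h : lpNormPos p (fun x => (f x : EReal)) < ∞) :
    ∫⁻ x in Ioi (0 : ℝ), ENNReal.ofReal (f x ^ p) ≠ ∞ := by
  rw [lpNormPos, lintegral_abs_coe_rpow hp.le hf] at h
  intro h'
  rw [h', ENNReal.top_rpow_of_pos (by positivity)] at h
  exact lt_irrefl _ h

theorem ofReal_mul_rpow_one_div (hp : 0 < p) {K : ℝ} (hK : 0 ≤ K) (Y : ℝ≥0∞) :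
    (ENNReal.ofReal K * Y) ^ (1 / p) = ENNReal.ofReal (K ^ (1 / p)) * Y ^ (1 / p) := by
  rw [ENNReal.mul_rpow_of_nonneg _ _ (by positivity), ENNReal.ofReal_rpow_of_nonneg hK
    (by positivity)]

/-- For a positive constant, the upper bound for step functions gives the one in `[0, ∞]`. -/
theorem lpNormPos_dualHardySubId_le {K : ℝ} (hK : 0 < K) (hp : 0 < p)
    (hstep : ∀ (h : ℝ) (c : ℕ → ℝ) (M : ℕ), IsStepSeq c M → 0 < h →
      ∫ x in Ioi (0 : ℝ), |gridHardy h c x - gridStep h c x| ^ p ≤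
        K * ∫ x in Ioi (0 : ℝ), gridStep h c x ^ p)
    (hf : NonnegNonincr f) :
    lpNormPos p (dualHardySubId f) ≤
      ENNReal.ofReal (K ^ (1 / p)) * lpNormPos p (fun x => (f x : EReal)) := by
  by_cases h : lpNormPos p (fun x => (f x : EReal)) < ∞
  · have hfin := lintegral_ne_top_of_lpNormPos_lt_top hp hf h
    rw [lpNormPos, lpNormPos, lintegral_abs_coe_rpow hp.le hf,
      lintegral_abs_dualHardySubId_rpow hp hf hfin, ← ofReal_mul_rpow_one_div hp hK.le]
    exact ENNReal.rpow_le_rpow (lintegral_abs_sub_rpow_le hK.le hp hstep hf hfin) (by positivity)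
  · rw [not_lt_top_iff.1 h, ENNReal.mul_top]
    · exact le_top
    · exact (ENNReal.ofReal_pos.2 (by positivity)).ne'

theorem le_lpNormPos_dualHardySubId {K : ℝ} (hK : 0 ≤ K) (hp : 1 ≤ p)
    (hstep : ∀ (h : ℝ) (c : ℕ → ℝ) (M : ℕ), IsStepSeq c M → 0 < h →
      K * ∫ x in Ioi (0 : ℝ), gridStep h c x ^ p ≤
        ∫ x in Ioi (0 : ℝ), |gridHardy h c x - gridStep h c x| ^ p)
    (hf : NonnegNonincr f) (h : lpNormPos p (fun x => (f x : EReal)) < ∞) :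
    ENNReal.ofReal (K ^ (1 / p)) * lpNormPos p (fun x => (f x : EReal)) ≤
      lpNormPos p (dualHardySubId f) := by
  have hp0 : 0 < p := by linarith
  have hfin := lintegral_ne_top_of_lpNormPos_lt_top hp0 hf h
  rw [lpNormPos, lpNormPos, lintegral_abs_coe_rpow hp0.le hf,
    lintegral_abs_dualHardySubId_rpow hp0 hf hfin, ← ofReal_mul_rpow_one_div hp0 hK]
  exact ENNReal.rpow_le_rpow (le_lintegral_abs_sub_rpow hK hp hstep hf hfin) (by positivity)

end

/-! ### The indicator function of `(0, 1)` -/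

section

variable {p : ℝ}

/-- The values `1, 0, 0, …`; with `h = 1` the step function is the indicator function of `(0, 1)`
on the half-line. -/
noncomputable def unitSeq (k : ℕ) : ℝ := if k = 0 then 1 else 0

theorem isStepSeq_unitSeq : IsStepSeq unitSeq 1 where
  antitone := by
    intro i j hij
    simp only [unitSeq]
    split_ifs <;> first | omega | norm_num
  nonneg := fun k => by
    simp only [unitSeq]
    split_ifs <;> norm_num
  eq_zero := fun k hk => if_neg (by omega)

theorem gridStep_unitSeq {x : ℝ} (hx : x ∈ Ioo (0 : ℝ) 1) : gridStep 1 unitSeq x = 1 := by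
  rw [gridStep_of_mem (j := 0) one_pos (by simpa using ⟨hx.1.le, hx.2⟩)]
  simp [unitSeq]

theorem gridHardy_unitSeq {x : ℝ} (hx : x ∈ Ioo (0 : ℝ) 1) :
    gridHardy 1 unitSeq x = Real.log (1 / x) := by
  have h := gridHardy_eq_add_log (j := 0) isStepSeq_unitSeq one_pos hx.1
    (by simpa using ⟨hx.1.le, hx.2.le⟩)
  have h1 : gridHardy 1 unitSeq 1 = 0 := gridHardy_eq_zero isStepSeq_unitSeq one_pos (by simp)
  simpa [unitSeq, h1] using h

theorem integral_gridStep_unitSeq_rpow (hp : 0 < p) :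
    ∫ x in Ioi (0 : ℝ), gridStep 1 unitSeq x ^ p = 1 := by
  rw [setIntegral_eq_of_subset_of_forall_sdiff_eq_zero (s := Ioo (0 : ℝ) 1) measurableSet_Ioi
    Ioo_subset_Ioi_self, setIntegral_congr_fun (g := fun _ => (1 : ℝ)) measurableSet_Ioo]
  · simp
  · intro x hx
    dsimp only
    rw [gridStep_unitSeq hx, Real.one_rpow]
  · intro x hx
    have h1 : 1 ≤ x := by
      by_contra h
      exact hx.2 ⟨hx.1, not_le.1 h⟩
    rw [gridStep_eq_zero isStepSeq_unitSeq one_pos (by simpa using h1), Real.zero_rpow hp.ne']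

theorem integral_abs_gridHardy_unitSeq_sub_rpow (hp : 0 < p) :
    ∫ x in Ioi (0 : ℝ), |gridHardy 1 unitSeq x - gridStep 1 unitSeq x| ^ p = hardyC p := by
  rw [setIntegral_eq_of_subset_of_forall_sdiff_eq_zero (s := Ioo (0 : ℝ) 1) measurableSet_Ioi
    Ioo_subset_Ioi_self, setIntegral_congr_fun (g := fun x => |Real.log (1 / x) - 1| ^ p)
    measurableSet_Ioo, integral_comp_log_div one_pos (fun s => |s - 1| ^ p), one_mul,
    hardyC_eq_integral_exp]
  · intro x hx
    dsimp only
    rw [gridStep_unitSeq hx, gridHardy_unitSeq hx]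
  · intro x hx
    have h1 : 1 ≤ x := by
      by_contra h
      exact hx.2 ⟨hx.1, not_le.1 h⟩
    rw [gridStep_eq_zero isStepSeq_unitSeq one_pos (by simpa using h1),
      gridHardy_eq_zero isStepSeq_unitSeq one_pos (by simpa using h1)]
    simp [hp.ne']

theorem nonnegNonincr_gridStep {h : ℝ} {c : ℕ → ℝ} {M : ℕ} (hc : IsStepSeq c M) (hh : 0 < h) :
    NonnegNonincr (gridStep h c) :=
  ⟨fun x _ => gridStep_nonneg hc x, fun _ _ _ _ hxy =>
    hc.antitone (Nat.floor_le_floor (div_le_div_of_nonneg_right hxy hh.le))⟩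

theorem lpNormPos_gridStep {h : ℝ} {c : ℕ → ℝ} {M : ℕ} (hp : 0 < p) (hc : IsStepSeq c M)
    (hh : 0 < h) :
    lpNormPos p (fun x => (gridStep h c x : EReal)) =
      ENNReal.ofReal (∫ x in Ioi (0 : ℝ), gridStep h c x ^ p) ^ (1 / p) := by
  rw [lpNormPos, lintegral_abs_coe_rpow hp.le (nonnegNonincr_gridStep hc hh),
    ofReal_integral_eq_lintegral_ofReal (integrableOn_gridStep_rpow hc hh hp)
      (Filter.Eventually.of_forall fun x => Real.rpow_nonneg (gridStep_nonneg hc x) p)]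

theorem lpNormPos_dualHardySubId_gridStep {h : ℝ} {c : ℕ → ℝ} {M : ℕ} (hp : 0 < p)
    (hc : IsStepSeq c M) (hh : 0 < h) :
    lpNormPos p (dualHardySubId (gridStep h c)) =
      ENNReal.ofReal (∫ x in Ioi (0 : ℝ), |gridHardy h c x - gridStep h c x| ^ p) ^ (1 / p) := by
  rw [lpNormPos, ofReal_integral_eq_lintegral_ofReal (integrableOn_abs_gridHardy_sub_rpow hp hc hh)
      (Filter.Eventually.of_forall fun x => Real.rpow_nonneg (abs_nonneg _) p)]
  congr 1
  refine setLIntegral_congr_fun measurableSet_Ioi fun x hx => ?_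
  have hd := dualHardy_gridStep hc hh hx
  rw [abs_dualHardySubId_rpow hp.le (by rw [hd]; exact ENNReal.ofReal_ne_top), hd,
    ENNReal.toReal_ofReal (gridHardy_nonneg hc hx)]

theorem hardyC_pos (hp : 0 < p) : 0 < hardyC p := by
  rw [hardyC_eq_integral_exp]
  have hi : IntegrableOn (fun s : ℝ => |s - 1| ^ p * Real.exp (-s)) (Ioi 0) := by
    simpa using integrableOn_abs_add_rpow hp.le 0 1
  rw [setIntegral_pos_iff_support_of_nonneg_ae
    (Filter.Eventually.of_forall fun s => by positivity) hi]
  refine lt_of_lt_of_le ?_ (measure_mono (s := Ioi (1 : ℝ)) fun s hs => ?_)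
  · simp
  · have hs : 1 < s := hs
    have h1 : 0 < |s - 1| := abs_pos.2 (by linarith)
    exact ⟨(by positivity : |s - 1| ^ p * Real.exp (-s) ≠ 0), mem_Ioi.2 (by linarith)⟩

/-- The indicator function of `(0, 1)` has norm `1` and is mapped to a function of norm
`C_p ^ (1 / p)`. -/
theorem le_of_lowerBoundOnCone_hardyC (hp : 0 < p) {c : ℝ≥0∞} (h : LowerBoundOnCone p c) :
    c ≤ ENNReal.ofReal (hardyC p ^ (1 / p)) := by
  have := h _ (nonnegNonincr_gridStep isStepSeq_unitSeq one_pos)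
  rw [lpNormPos_gridStep hp isStepSeq_unitSeq one_pos,
    lpNormPos_dualHardySubId_gridStep hp isStepSeq_unitSeq one_pos,
    integral_gridStep_unitSeq_rpow hp, integral_abs_gridHardy_unitSeq_sub_rpow hp,
    ENNReal.ofReal_rpow_of_nonneg (hardyC_pos hp).le (by positivity)] at this
  simpa using this

theorem le_of_upperBoundOnCone_hardyC (hp : 0 < p) {c : ℝ≥0∞} (h : UpperBoundOnCone p c) :
    ENNReal.ofReal (hardyC p ^ (1 / p)) ≤ c := by
  have := h _ (nonnegNonincr_gridStep isStepSeq_unitSeq one_pos)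
  rw [lpNormPos_gridStep hp isStepSeq_unitSeq one_pos,
    lpNormPos_dualHardySubId_gridStep hp isStepSeq_unitSeq one_pos,
    integral_gridStep_unitSeq_rpow hp, integral_abs_gridHardy_unitSeq_sub_rpow hp,
    ENNReal.ofReal_rpow_of_nonneg (hardyC_pos hp).le (by positivity)] at this
  simpa using this

/-! ### Truncated powers -/

/-- The power `x ^ (-a)`, replaced by its value at `1` to the left of `1`. -/
noncomputable def truncPow (a x : ℝ) : ℝ := (max x 1) ^ (-a)

variable {a : ℝ}

theorem nonnegNonincr_truncPow (ha : 0 < a) : NonnegNonincr (truncPow a) :=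
  ⟨fun x _ => by unfold truncPow; positivity, fun x _ y _ hxy =>
    Real.rpow_le_rpow_of_nonpos (by positivity) (max_le_max_right 1 hxy) (by linarith)⟩

theorem truncPow_of_le_one {x : ℝ} (hx : x ≤ 1) : truncPow a x = 1 := by
  rw [truncPow, max_eq_right hx, Real.one_rpow]

theorem truncPow_of_one_le {x : ℝ} (hx : 1 ≤ x) : truncPow a x = x ^ (-a) := by
  rw [truncPow, max_eq_left hx]

theorem lintegral_Ioi_rpow {r c : ℝ} (hr : r < -1) (hc : 0 < c) :
    ∫⁻ x in Ioi c, ENNReal.ofReal (x ^ r) = ENNReal.ofReal (c ^ (r + 1) / -(r + 1)) := by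
  rw [← ofReal_integral_eq_lintegral_ofReal (integrableOn_Ioi_rpow_of_lt hr hc),
    integral_Ioi_rpow_of_lt hr hc, neg_div, div_neg]
  filter_upwards [ae_restrict_mem measurableSet_Ioi] with x hx
  exact Real.rpow_nonneg (hc.trans hx).le r

theorem lintegral_Ioi_rpow_neg_mul (hap : 1 < a * p) :
    ∫⁻ x in Ioi (1 : ℝ), ENNReal.ofReal ((x ^ (-a)) ^ p) = ENNReal.ofReal (1 / (a * p - 1)) := by
  rw [setLIntegral_congr_fun (g := fun x => ENNReal.ofReal (x ^ (-a * p))) measurableSet_Ioi,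
    lintegral_Ioi_rpow (by linarith) one_pos, Real.one_rpow]
  · congr 2; ring
  · intro x hx
    have hx : 0 < x := one_pos.trans hx
    dsimp only
    rw [Real.rpow_mul hx.le]

theorem setLIntegral_Ioi_zero_eq_add (g : ℝ → ℝ≥0∞) :
    ∫⁻ x in Ioi (0 : ℝ), g x = (∫⁻ x in Ioc 0 1, g x) + ∫⁻ x in Ioi 1, g x := by
  rw [← Ioc_union_Ioi_eq_Ioi zero_le_one,
    lintegral_union measurableSet_Ioi (Ioc_disjoint_Ioi le_rfl)]

theorem lintegral_truncPow_rpow (hap : 1 < a * p) :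
    ∫⁻ x in Ioi (0 : ℝ), ENNReal.ofReal (truncPow a x ^ p) =
      ENNReal.ofReal (1 + 1 / (a * p - 1)) := by
  rw [setLIntegral_Ioi_zero_eq_add, setLIntegral_congr_fun (g := fun _ => 1) measurableSet_Ioc,
    setLIntegral_congr_fun (s := Ioi 1) (g := fun x => ENNReal.ofReal ((x ^ (-a)) ^ p))
      measurableSet_Ioi, lintegral_Ioi_rpow_neg_mul hap, setLIntegral_const, Real.volume_Ioc,
    ENNReal.ofReal_add zero_le_one (div_nonneg zero_le_one (by linarith))]
  · simp
  · intro x hx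
    dsimp only
    rw [truncPow_of_one_le (le_of_lt hx)]
  · intro x hx
    dsimp only
    rw [truncPow_of_le_one hx.2, Real.one_rpow, ENNReal.ofReal_one]

theorem dualHardy_truncPow_of_one_le (ha : 0 < a) {x : ℝ} (hx : 1 ≤ x) :
    dualHardy (truncPow a) x = ENNReal.ofReal (x ^ (-a) / a) := by
  have hx0 : 0 < x := by linarith
  rw [dualHardy, setLIntegral_congr_fun (g := fun t => ENNReal.ofReal (t ^ (-a - 1)))
    measurableSet_Ioi, lintegral_Ioi_rpow (by linarith) hx0]
  · congr 2 <;> ring_nf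
  · intro t ht
    have ht : x < t := ht
    dsimp only
    rw [truncPow_of_one_le (by linarith), Real.rpow_sub_one (by linarith)]

theorem dualHardy_truncPow_of_le_one (ha : 0 < a) {x : ℝ} (hx0 : 0 < x) (hx : x ≤ 1) :
    dualHardy (truncPow a) x = ENNReal.ofReal (Real.log (1 / x) + 1 / a) := by
  have hlog : 0 ≤ Real.log (1 / x) := Real.log_nonneg (by rwa [one_le_div hx0])
  have h1 : ∫⁻ t in Ioc x 1, ENNReal.ofReal (truncPow a t / t) =
      ENNReal.ofReal (Real.log (1 / x)) := by
    rw [← integral_inv_of_pos hx0 one_pos, intervalIntegral.integral_of_le hx,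
      ofReal_integral_eq_lintegral_ofReal]
    · refine setLIntegral_congr_fun measurableSet_Ioc fun t ht => ?_
      rw [truncPow_of_le_one ht.2, one_div]
    · exact (intervalIntegrable_iff_integrableOn_Ioc_of_le hx).1
        (intervalIntegral.intervalIntegrable_inv
          (fun t ht => by rw [uIcc_of_le hx] at ht; exact (hx0.trans_le ht.1).ne') continuousOn_id)
    · filter_upwards [ae_restrict_mem measurableSet_Ioc] with t ht
      exact inv_nonneg.2 (hx0.trans ht.1).le
  have h2 := dualHardy_truncPow_of_one_le ha le_rfl
  rw [dualHardy, Real.one_rpow] at h2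
  rw [dualHardy, ← Ioc_union_Ioi_eq_Ioi hx,
    lintegral_union measurableSet_Ioi (Ioc_disjoint_Ioi le_rfl), h1, h2,
    ← ENNReal.ofReal_add hlog (by positivity)]

theorem lintegral_Ioi_one_abs_dualHardySubId_truncPow (hp : 0 < p) (ha : 0 < a)
    (hap : 1 < a * p) :
    ∫⁻ x in Ioi (1 : ℝ), (dualHardySubId (truncPow a) x).abs ^ p =
      ENNReal.ofReal (|1 / a - 1| ^ p / (a * p - 1)) := by
  rw [setLIntegral_congr_fun (g := fun x => ENNReal.ofReal (|1 / a - 1| ^ p) *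
      ENNReal.ofReal ((x ^ (-a)) ^ p)) measurableSet_Ioi,
    lintegral_const_mul' _ _ ENNReal.ofReal_ne_top, lintegral_Ioi_rpow_neg_mul hap,
    ← ENNReal.ofReal_mul (by positivity), mul_one_div]
  intro x hx
  have hx : 1 < x := hx
  have hd := dualHardy_truncPow_of_one_le ha hx.le
  have hpos : 0 ≤ x ^ (-a) := Real.rpow_nonneg (by linarith) _
  dsimp only
  rw [abs_dualHardySubId_rpow hp.le (by rw [hd]; exact ENNReal.ofReal_ne_top), hd,
    ENNReal.toReal_ofReal (by positivity), truncPow_of_one_le hx.le,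
    ← ENNReal.ofReal_mul (by positivity), ← Real.mul_rpow (abs_nonneg _) hpos]
  congr 2
  rw [← abs_of_nonneg hpos, ← abs_mul, abs_of_nonneg hpos]
  congr 1; ring

/-- The bound does not depend on `a > 1 / p`. -/
theorem lintegral_Ioc_abs_dualHardySubId_truncPow_le (hp : 0 < p) (ha : 0 < a)
    (hap : 1 < a * p) :
    ∫⁻ x in Ioc (0 : ℝ) 1, (dualHardySubId (truncPow a) x).abs ^ p ≤
      ENNReal.ofReal (∫ s in Ioi (0 : ℝ), ((p + 1) + 1 * s) ^ p * Real.exp (-s)) := by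
  have hi := integrableOn_add_mul_rpow hp.le (by linarith : 0 ≤ p + 1) zero_le_one
  have hi' := integrableOn_comp_log_div (g := fun s => ((p + 1) + 1 * s) ^ p) one_pos hi
  have he := integral_comp_log_div one_pos (fun s => ((p + 1) + 1 * s) ^ p)
  have hlog : ∀ x ∈ Ioo (0 : ℝ) 1, 0 ≤ Real.log (1 / x) := fun x hx =>
    Real.log_nonneg (by rw [one_le_div hx.1]; exact hx.2.le)
  rw [one_mul] at he
  rw [← he, ofReal_integral_eq_lintegral_ofReal hi', restrict_Ioo_eq_restrict_Ioc.symm]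
  · refine setLIntegral_mono' measurableSet_Ioo fun x hx => ?_
    have hd := dualHardy_truncPow_of_le_one ha hx.1 hx.2.le
    have h0 := hlog x hx
    have h1 : 0 < 1 / a := by positivity
    have h2 : 1 / a ≤ p := by rw [div_le_iff₀ ha]; linarith
    rw [abs_dualHardySubId_rpow hp.le (by rw [hd]; exact ENNReal.ofReal_ne_top), hd,
      ENNReal.toReal_ofReal (by positivity), truncPow_of_le_one hx.2.le]
    refine ENNReal.ofReal_le_ofReal (Real.rpow_le_rpow (abs_nonneg _) ?_ hp.le)
    rw [abs_le]; constructor <;> linarith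
  · filter_upwards [ae_restrict_mem measurableSet_Ioo] with x hx
    have h0 := hlog x hx
    exact Real.rpow_nonneg (by positivity) _

theorem lpNormPos_truncPow (hp : 0 < p) (ha : 0 < a) (hap : 1 < a * p) :
    lpNormPos p (fun x => (truncPow a x : EReal)) =
      ENNReal.ofReal (1 + 1 / (a * p - 1)) ^ (1 / p) := by
  rw [lpNormPos, lintegral_abs_coe_rpow hp.le (nonnegNonincr_truncPow ha),
    lintegral_truncPow_rpow hap]

theorem lpNormPos_truncPow_lt_top (hp : 0 < p) (ha : 0 < a) (hap : 1 < a * p) :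
    lpNormPos p (fun x => (truncPow a x : EReal)) < ∞ := by
  rw [lpNormPos_truncPow hp ha hap]
  exact ENNReal.rpow_lt_top_of_nonneg (by positivity) ENNReal.ofReal_ne_top

theorem rpow_rpow_one_div (hp : 0 < p) (y : ℝ≥0∞) : (y ^ (1 / p)) ^ p = y := by
  rw [← ENNReal.rpow_mul, one_div_mul_cancel hp.ne', ENNReal.rpow_one]

/-- `‖(H* - I) f‖_p ^ p ≤ K + |p / (1 + δ) - 1| ^ p / δ` and `‖f‖_p ^ p = 1 + 1 / δ` for the
truncated power with exponent `a = (1 + δ) / p`; let `δ → 0`. -/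
theorem le_of_lowerBoundOnCone_sub_one (hp : 1 ≤ p) {c : ℝ≥0∞} (h : LowerBoundOnCone p c) :
    c ≤ ENNReal.ofReal (p - 1) := by
  have hp0 : 0 < p := by linarith
  set K := ∫ s in Ioi (0 : ℝ), ((p + 1) + 1 * s) ^ p * Real.exp (-s)
  have hK : 0 ≤ K := setIntegral_nonneg measurableSet_Ioi fun s hs => by
    have : 0 < s := hs
    positivity
  have key : ∀ δ : ℝ, 0 < δ → c ^ p ≤ ENNReal.ofReal (K * δ + |p / (1 + δ) - 1| ^ p) := by
    intro δ hδ
    have ha : 0 < (1 + δ) / p := by positivity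
    have hap : (1 + δ) / p * p = 1 + δ := by field_simp
    have hap1 : 1 < (1 + δ) / p * p := by linarith
    have h1 := h _ (nonnegNonincr_truncPow ha) (lpNormPos_truncPow_lt_top hp0 ha hap1)
    rw [lpNormPos_truncPow hp0 ha hap1, lpNormPos] at h1
    have h2 := ENNReal.rpow_le_rpow h1 hp0.le
    rw [ENNReal.mul_rpow_of_nonneg _ _ hp0.le, rpow_rpow_one_div hp0, rpow_rpow_one_div hp0,
      setLIntegral_Ioi_zero_eq_add, lintegral_Ioi_one_abs_dualHardySubId_truncPow hp0 ha hap1] at h2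
    have h3 := h2.trans (add_le_add_left
      (lintegral_Ioc_abs_dualHardySubId_truncPow_le hp0 ha hap1) _)
    rw [← ENNReal.ofReal_add hK (div_nonneg (by positivity) (by linarith)), hap, one_div_div,
      add_sub_cancel_left] at h3
    have h4 := mul_le_mul_left h3 (ENNReal.ofReal δ)
    rw [mul_assoc, ← ENNReal.ofReal_mul (by positivity), ← ENNReal.ofReal_mul (by positivity)] at h4
    calc c ^ p ≤ c ^ p * ENNReal.ofReal ((1 + 1 / δ) * δ) := by
          refine le_mul_of_one_le_right' ?_
          rw [ENNReal.one_le_ofReal, add_mul, one_div_mul_cancel hδ.ne']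
          linarith
      _ ≤ _ := h4
      _ = _ := by rw [add_mul, div_mul_cancel₀ _ hδ.ne']
  have hlim : Filter.Tendsto (fun δ : ℝ => ENNReal.ofReal (K * δ + |p / (1 + δ) - 1| ^ p))
      (nhdsWithin 0 (Ioi 0)) (nhds (ENNReal.ofReal ((p - 1) ^ p))) := by
    have hc : ContinuousAt (fun δ : ℝ => K * δ + |p / (1 + δ) - 1| ^ p) 0 := by
      refine ContinuousAt.add (by fun_prop) (ContinuousAt.rpow_const ?_ (Or.inr hp0.le))
      exact ContinuousAt.abs ((continuousAt_const.div (by fun_prop) (by norm_num)).sub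
        continuousAt_const)
    have := hc.tendsto.mono_left (nhdsWithin_le_nhds (s := Ioi 0))
    simp only [mul_zero, add_zero, div_one, zero_add, abs_of_nonneg (by linarith : 0 ≤ p - 1)]
      at this
    exact ENNReal.tendsto_ofReal this
  have hle : c ^ p ≤ ENNReal.ofReal ((p - 1) ^ p) :=
    ge_of_tendsto hlim (by filter_upwards [self_mem_nhdsWithin] with δ hδ using key δ hδ)
  rw [← ENNReal.ofReal_rpow_of_nonneg (by linarith) hp0.le] at hle
  exact (ENNReal.rpow_le_rpow_iff hp0).1 hle

/-- As in `le_of_lowerBoundOnCone_sub_one`, but the part of `‖(H* - I) f‖_p ^ p` over `(0, 1)` is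
dropped. -/
theorem le_of_upperBoundOnCone_sub_one (hp : 1 ≤ p) {c : ℝ≥0∞} (h : UpperBoundOnCone p c) :
    ENNReal.ofReal (p - 1) ≤ c := by
  have hp0 : 0 < p := by linarith
  have key : ∀ δ : ℝ, 0 < δ → ENNReal.ofReal (|p / (1 + δ) - 1| ^ p / (1 + δ)) ≤ c ^ p := by
    intro δ hδ
    have ha : 0 < (1 + δ) / p := by positivity
    have hap : (1 + δ) / p * p = 1 + δ := by field_simp
    have hap1 : 1 < (1 + δ) / p * p := by linarith
    have h1 := h _ (nonnegNonincr_truncPow ha) (lpNormPos_truncPow_lt_top hp0 ha hap1)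
    rw [lpNormPos_truncPow hp0 ha hap1, lpNormPos] at h1
    have h2 := ENNReal.rpow_le_rpow h1 hp0.le
    rw [ENNReal.mul_rpow_of_nonneg _ _ hp0.le, rpow_rpow_one_div hp0, rpow_rpow_one_div hp0,
      setLIntegral_Ioi_zero_eq_add, lintegral_Ioi_one_abs_dualHardySubId_truncPow hp0 ha hap1] at h2
    have h3 := le_add_self.trans h2
    rw [hap, one_div_div, add_sub_cancel_left, show 1 + 1 / δ = (1 + δ) / δ by field_simp; ring]
      at h3
    rw [show |p / (1 + δ) - 1| ^ p / (1 + δ) = |p / (1 + δ) - 1| ^ p / δ / ((1 + δ) / δ) by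
      field_simp, ENNReal.ofReal_div_of_pos (by positivity)]
    exact ENNReal.div_le_of_le_mul h3
  have hlim : Filter.Tendsto (fun δ : ℝ => ENNReal.ofReal (|p / (1 + δ) - 1| ^ p / (1 + δ)))
      (nhdsWithin 0 (Ioi 0)) (nhds (ENNReal.ofReal ((p - 1) ^ p))) := by
    have hc : ContinuousAt (fun δ : ℝ => |p / (1 + δ) - 1| ^ p / (1 + δ)) 0 := by
      refine ContinuousAt.div (ContinuousAt.rpow_const ?_ (Or.inr hp0.le)) (by fun_prop)
        (by norm_num)
      exact ContinuousAt.abs ((continuousAt_const.div (by fun_prop) (by norm_num)).sub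
        continuousAt_const)
    have := hc.tendsto.mono_left (nhdsWithin_le_nhds (s := Ioi 0))
    simp only [add_zero, div_one, abs_of_nonneg (by linarith : 0 ≤ p - 1)] at this
    exact ENNReal.tendsto_ofReal this
  have hle : ENNReal.ofReal ((p - 1) ^ p) ≤ c ^ p :=
    le_of_tendsto hlim (by filter_upwards [self_mem_nhdsWithin] with δ hδ using key δ hδ)
  rw [← ENNReal.ofReal_rpow_of_nonneg (by linarith) hp0.le] at hle
  exact (ENNReal.rpow_le_rpow_iff hp0).1 hle

end

/-! ### Sharp norm inequalities -/

theorem sub_one_rpow_rpow_one_div {p : ℝ} (hp : 1 ≤ p) : ((p - 1) ^ p) ^ (1 / p) = p - 1 := by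
  rw [← Real.rpow_mul (by linarith), mul_one_div_cancel (by linarith), Real.rpow_one]

theorem theorem1p2 (p : ℝ) (hp : 1 ≤ p) :
    (p ≤ 2 →
      (∀ f : ℝ → ℝ, NonnegNonincr f →
        (lpNormPos p (fun x => (f x : EReal)) < ∞ →
          ENNReal.ofReal (p - 1) * lpNormPos p (fun x => (f x : EReal))
            ≤ lpNormPos p (dualHardySubId f)) ∧
        lpNormPos p (dualHardySubId f)
          ≤ ENNReal.ofReal (hardyC p ^ (1 / p)) * lpNormPos p (fun x => (f x : EReal))) ∧
      (∀ c : ℝ≥0∞, LowerBoundOnCone p c → c ≤ ENNReal.ofReal (p - 1)) ∧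
      (∀ c : ℝ≥0∞, UpperBoundOnCone p c → ENNReal.ofReal (hardyC p ^ (1 / p)) ≤ c)) ∧
    (2 ≤ p →
      (∀ f : ℝ → ℝ, NonnegNonincr f →
        (lpNormPos p (fun x => (f x : EReal)) < ∞ →
          ENNReal.ofReal (hardyC p ^ (1 / p)) * lpNormPos p (fun x => (f x : EReal))
            ≤ lpNormPos p (dualHardySubId f)) ∧
        lpNormPos p (dualHardySubId f)
          ≤ ENNReal.ofReal (p - 1) * lpNormPos p (fun x => (f x : EReal))) ∧
      (∀ c : ℝ≥0∞, LowerBoundOnCone p c → c ≤ ENNReal.ofReal (hardyC p ^ (1 / p))) ∧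
      (∀ c : ℝ≥0∞, UpperBoundOnCone p c → ENNReal.ofReal (p - 1) ≤ c)) := by
  have hp0 : 0 < p := by linarith
  refine ⟨fun hp2 => ⟨fun f hf => ⟨fun hfin => ?_, ?_⟩, fun c hc =>
      le_of_lowerBoundOnCone_sub_one hp hc, fun c hc => le_of_upperBoundOnCone_hardyC hp0 hc⟩,
    fun hp2 => ⟨fun f hf => ⟨fun hfin => ?_, ?_⟩, fun c hc =>
      le_of_lowerBoundOnCone_hardyC hp0 hc, fun c hc => le_of_upperBoundOnCone_sub_one hp hc⟩⟩
  · rcases hp.eq_or_lt with rfl | hp1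
    · simp
    · rw [← sub_one_rpow_rpow_one_div hp]
      exact le_lpNormPos_dualHardySubId (Real.rpow_nonneg (by linarith) p) hp
        (fun _ _ _ hc hh => le_integral_abs_gridHardy_sub_rpow hp1 hp2 hc hh) hf hfin
  · exact lpNormPos_dualHardySubId_le (hardyC_pos hp0) hp0
      (fun _ _ _ hc hh => integral_abs_gridHardy_sub_rpow_le_hardyC hp hp2 hc hh) hf
  · exact le_lpNormPos_dualHardySubId (hardyC_pos hp0).le hp
      (fun _ _ _ hc hh => hardyC_mul_le_integral_abs_gridHardy_sub_rpow hp2 hc hh) hf hfin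
  · rw [← sub_one_rpow_rpow_one_div hp]
    exact lpNormPos_dualHardySubId_le (Real.rpow_pos_of_pos (by linarith) p) hp0
      (fun _ _ _ hc hh => integral_abs_gridHardy_sub_rpow_le hp2 hc hh) hf
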